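/- **Definitions.** Let $r\ge 3$. A *hypergraph* here is finite, with a set of vertices and a set of edges, each edge being a set of vertices; it is *$r$-uniform* if every edge has exactly $r$ vertices. An *$r$-uniform supertree* is a connected $r$-uniform hypergraph without cycles, where a cycle is a cyclic sequence $v_1e_1v_2e_2\cdots v_\ell e_\ell v_1$ with $\ell\ge 2$, distinct vertices $v_i$, distinct edges $e_i$ and $v_i,v_{i+1}\in e_i$ (indices modulo $\ell$). A single vertex without edges is a supertree. For an $r$-uniform hypergraph $\mathcal H$ with vertex set $[n]$, the *adjacency tensor* $\mathcal A(\mathcal H)=(a_{i_1\cdots i_r})$ has entries $a_{i_1\cdots i_r}=\frac{1}{(r-1)!}$ if $\{i_1,\dots,i_r\}$ is an edge and $0$ otherwise. A number $\lambda\in\mathbb C$ is an *eigenvalue* of it if there is a nonzero $x\in\mathbb C^n$ with $\sum_{i_2,\dots,i_r=1}^{n}a_{i i_2\cdots i_r}x_{i_2}\cdots x_{i_r}=\lambda x_i^{\,r-1}$ for all $i\in[n]$. The *spectral radius* $\rho(\mathcal H)$ is the maximum modulus of an eigenvalue. The *matching polynomial* is $\varphi(\mathcal H,x)=\sum_{k\ge0}(-1)^k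 m(\mathcal H,k)\,x^{n-kr}$, where $m(\mathcal H,k)$ is the number of sets of $k$ pairwise disjoint edges, and the *matching energy* $ME(\mathcal H)$ is the sum of the absolute values of all complex roots of $\varphi(\mathcal H,x)$, counted with multiplicity. The *loose path* $\mathcal P^r_t$ has distinct vertices $v_1,\dots,v_{t+1}$ and $u_{i,1},\dots,u_{i,r-2}$ $(1\le i\le t)$, and edges $e_i=\{v_i,u_{i,1},\dots,u_{i,r-2},v_{i+1}\}$. *Attaching a pendent edge* at a vertex $v$ means adding $r-1$ new vertices and the edge formed by them and $v$; the new vertices are the pendent vertices of that edge. For positive integers $a,b,c,d$, $\mathcal R(a,b,c,d)$ is obtained from $\mathcal P^r_{a+b+c+d}$ by attaching one pendent edge at each of the vertices $v_{a+1}$, $v_{a+b+1}$ and $v_{a+b+c+1}$. For hypergraphs $\mathcal G,\Gamma$ with disjoint vertex sets and vertices $u$ of $\mathcal G$, $w$ of $\Gamma$, $\mathcal G_u\cdot\Gamma_w$ is the hypergraph obtained from them by identifying $u$ with $w$. **Theorem.** Let $r\ge 3$, let $\Gamma$ be an $r$-uniform supertree and $w\in V(\Gamma)$. Let $u$ be a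 pendent vertex of the pendent edge attached at $v_3$ in $\mathcal R(1,1,2,4)$, and let $v$ be a pendent vertex of the pendent edge attached at $v_6$ in $\mathcal R(1,3,1,3)$. Then the maxima defining the spectral radii of the two glued hypergraphs exist, and $$\rho\big(\mathcal R(1,1,2,4)_u\cdot\Gamma_w\big)=\rho\big(\mathcal R(1,3,1,3)_v\cdot\Gamma_w\big),\qquad ME\big(\mathcal R(1,1,2,4)_u\cdot\Gamma_w\big)=ME\big(\mathcal R(1,3,1,3)_v\cdot\Gamma_w\big).$$ -/

import Mathlib

open Polynomial

noncomputable section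

namespace Hypergraph

variable {α β : Type*}

/-! ### Uniform supertrees -/

/-- Every edge has exactly `r` vertices. -/
def IsUniform (H : Hypergraph α) (r : ℕ) : Prop :=
  ∀ e ∈ H.edgeSet, e.ncard = r

/-- The hypergraph has a vertex, and any two of its vertices are joined by a walk. -/
def IsConnected (H : Hypergraph α) : Prop :=
  H.vertexSet.Nonempty ∧
    ∀ x ∈ H.vertexSet, ∀ y ∈ H.vertexSet, Relation.ReflTransGen H.Adj x y

/-- There is no (Berge) cycle `v₀ e₀ v₁ e₁ … v_{ℓ-1} e_{ℓ-1} v₀` of length `ℓ = n + 2 ≥ 2`, with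
distinct vertices `vᵢ`, distinct edges `eᵢ` and `vᵢ, vᵢ₊₁ ∈ eᵢ`. The index `i + 1` is taken
modulo `ℓ`. -/
def IsAcyclic (H : Hypergraph α) : Prop :=
  ¬ ∃ (n : ℕ) (v : Fin (n + 2) → α) (e : Fin (n + 2) → Set α),
    Function.Injective v ∧ Function.Injective e ∧
      ∀ i, e i ∈ H.edgeSet ∧ v i ∈ e i ∧ v (i + 1) ∈ e i

/-- A (finite) `r`-uniform supertree: a connected acyclic `r`-uniform hypergraph. -/
structure IsSupertree (H : Hypergraph α) (r : ℕ) : Prop where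
  finite : H.vertexSet.Finite
  uniform : H.IsUniform r
  connected : H.IsConnected
  acyclic : H.IsAcyclic

/-! ### Matching polynomial and matching energy -/

/-- The number `m(H, k)` of sets of `k` pairwise disjoint edges. -/
def numMatchings (H : Hypergraph α) (k : ℕ) : ℕ :=
  {M : Set (Set α) | M ⊆ H.edgeSet ∧ M.ncard = k ∧ M.PairwiseDisjoint id}.ncard

/-- The matching polynomial `∑ₖ (-1)ᵏ m(H, k) x^(n - k r)` of an `r`-uniform hypergraph `H` with
`n` vertices (for `r ≥ 1` there is no `k`-matching unless `k r ≤ n`, so that the exponents are not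
truncated in any nonzero term, and all `k > n` contribute nothing). -/
def matchingPolynomial (H : Hypergraph α) (r : ℕ) : ℂ[X] :=
  ∑ k ∈ Finset.range (H.vertexSet.ncard + 1),
    C ((-1) ^ k * (H.numMatchings k : ℂ)) * X ^ (H.vertexSet.ncard - k * r)

/-- The matching energy: the sum of the absolute values of all complex roots of the matching
polynomial, counted with multiplicity. -/
def matchingEnergy (H : Hypergraph α) (r : ℕ) : ℝ :=
  ((H.matchingPolynomial r).roots.map fun z => ‖z‖).sum

/-! ### Tensors, eigenvalues and the spectral radius -/

/-- For a tensor `A` of order `m + 1` with (finite) index set `ι` and a vector `x`, the vector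
`A x` with `(A x)ᵢ = ∑_{i₂, …, i_{m+1}} a_{i i₂ … i_{m+1}} x_{i₂} ⋯ x_{i_{m+1}}`. -/
def tensorApply {ι : Type*} {m : ℕ} (A : (Fin (m + 1) → ι) → ℂ) (x : ι → ℂ) (i : ι) : ℂ :=
  ∑ᶠ g : Fin m → ι, A (Fin.cons i g) * ∏ j, x (g j)

/-- `μ` is an eigenvalue of the tensor `A` of order `m + 1`: there is a nonzero complex vector `x`
with `(A x)ᵢ = μ xᵢ ^ m` for all `i`. -/
def IsTensorEigenvalue {ι : Type*} {m : ℕ} (A : (Fin (m + 1) → ι) → ℂ) (μ : ℂ) : Prop :=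
  ∃ x : ι → ℂ, x ≠ 0 ∧ ∀ i, tensorApply A x i = μ * x i ^ m

open Classical in
/-- The adjacency tensor of order `m + 1` of an `(m + 1)`-uniform hypergraph: the entry at
`(i₁, …, i_{m+1})` is `1 / m!` if `{i₁, …, i_{m+1}}` is an edge, and `0` otherwise. -/
def adjacencyTensor (H : Hypergraph α) (m : ℕ) (i : Fin (m + 1) → H.vertexSet) : ℂ :=
  if Set.range (fun j => (i j : α)) ∈ H.edgeSet then 1 / (m.factorial : ℂ) else 0

/-- The moduli of the eigenvalues of the adjacency tensor (of order `r = (r - 1) + 1`) of an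
`r`-uniform hypergraph, `r ≥ 1`. -/
def eigenvalueModuli (H : Hypergraph α) (r : ℕ) : Set ℝ :=
  {t | ∃ μ : ℂ, IsTensorEigenvalue (H.adjacencyTensor (r - 1)) μ ∧ t = ‖μ‖}

/-- The spectral radius of an `r`-uniform hypergraph: the largest modulus of an eigenvalue of its
adjacency tensor. -/
def spectralRadius (H : Hypergraph α) (r : ℕ) : ℝ :=
  sSup (H.eigenvalueModuli r)

/-! ### Gluing, and the supertrees `R(a, b, c, d)` -/

open Classical in
/-- The hypergraph `G_u · Γ_w` obtained from disjoint copies of `G` and `Γ` by identifying the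
vertex `w` of `Γ` with the vertex `u` of `G`: the copy of `Γ` has its vertex `w` renamed to `u`.
The identified vertex is `Sum.inl u` (and `Sum.inr w` is not a vertex). -/
def glue (G : Hypergraph α) (u : α) (Γ : Hypergraph β) (w : β) : Hypergraph (α ⊕ β) where
  vertexSet := (G.image Sum.inl).vertexSet ∪
    (Γ.image (Function.update Sum.inr w (Sum.inl u))).vertexSet
  edgeSet := (G.image Sum.inl).edgeSet ∪
    (Γ.image (Function.update Sum.inr w (Sum.inl u))).edgeSet
  subset_vertexSet_of_mem_edgeSet' := by
    rintro e (he | he)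
    · exact (subset_vertexSet_of_mem_edgeSet he).trans Set.subset_union_left
    · exact (subset_vertexSet_of_mem_edgeSet he).trans Set.subset_union_right

/-- The hypergraph with `r` vertices `none`, `some 0`, …, `some (r - 2)` and a single edge, which
consists of all of them (`r ≥ 1`). -/
def singleEdge (r : ℕ) : Hypergraph (Option (Fin (r - 1))) where
  vertexSet := Set.univ
  edgeSet := {Set.univ}
  subset_vertexSet_of_mem_edgeSet' := fun _ _ => Set.subset_univ _

/-- Attach one new edge with `r` vertices at the vertex `v` of `H`: the new edge consists of `v`
and of the `r - 1` new vertices `Sum.inr (some j)`, `j : Fin (r - 1)`. -/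
def attachPendentEdge (H : Hypergraph α) (v : α) (r : ℕ) :
    Hypergraph (α ⊕ Option (Fin (r - 1))) :=
  H.glue v (singleEdge r) none

/-- Vertices of the loose path of length `t`: `Sum.inl i` is the path vertex `v_{i+1}`, and
`Sum.inr (i, j)` is the `j`-th additional vertex of the edge joining `v_{i+1}` and `v_{i+2}`. -/
abbrev PathVertex (r t : ℕ) : Type := Fin (t + 1) ⊕ (Fin t × Fin (r - 2))

/-- The loose path of length `t`, i.e. the `r`-th power of the ordinary path of length `t`
(`r ≥ 2`). -/
def loosePath (r t : ℕ) : Hypergraph (PathVertex r t) where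
  vertexSet := Set.univ
  edgeSet := Set.range fun i : Fin t =>
    {Sum.inl i.castSucc, Sum.inl i.succ} ∪ Set.range fun j : Fin (r - 2) => Sum.inr (i, j)
  subset_vertexSet_of_mem_edgeSet' := fun _ _ => Set.subset_univ _

/-- The type in which the vertices of `R(a, b, c, d)` live. -/
abbrev RVertex (r a b c d : ℕ) : Type :=
  ((PathVertex r (a + b + c + d) ⊕ Option (Fin (r - 1))) ⊕ Option (Fin (r - 1))) ⊕
    Option (Fin (r - 1))

/-- The hypergraph `R(a, b, c, d)`, obtained from the loose path of length `a + b + c + d` by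
attaching one pendent edge at each of `v_{a+1}`, `v_{a+b+1}` and `v_{a+b+c+1}` (in this order). -/
def supertreeR (r a b c d : ℕ) : Hypergraph (RVertex r a b c d) :=
  (((loosePath r (a + b + c + d)).attachPendentEdge
      (Sum.inl ⟨a, by omega⟩) r).attachPendentEdge
      (Sum.inl (Sum.inl ⟨a + b, by omega⟩)) r).attachPendentEdge
      (Sum.inl (Sum.inl (Sum.inl ⟨a + b + c, by omega⟩))) r

/-- The pendent vertices of the pendent edge of `R(a, b, c, d)` attached at `v_{a+b+1}`. -/
def pendentAtSecond (r a b c d : ℕ) (j : Fin (r - 1)) : RVertex r a b c d :=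
  Sum.inl (Sum.inr (some j))

/-- The pendent vertices of the pendent edge of `R(a, b, c, d)` attached at `v_{a+b+c+1}`. -/
def pendentAtThird (r a b c d : ℕ) (j : Fin (r - 1)) : RVertex r a b c d :=
  Sum.inr (some j)

end Hypergraph

end

namespace SetFamily

open Finset

variable {V ι : Type*} [DecidableEq V] [Fintype ι]

/-! ### Supersolutions and Perron–Frobenius theory for uniform set families. -/

/-- The sum over the members of `E` containing `i` of the products of `x` over these members. -/
def edgeSum (E : ι → Finset V) (x : V → ℝ) (i : V) : ℝ :=
  ∑ e with i ∈ E e, ∏ k ∈ E e, x k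

/-- `x` is positive and `∑_{e ∋ i} ∏_{k ∈ e} x k ≤ t * x i ^ r` for all `i`. -/
def IsSupersolution (E : ι → Finset V) (r : ℕ) (t : ℝ) (x : V → ℝ) : Prop :=
  (∀ i, 0 < x i) ∧ ∀ i, edgeSum E x i ≤ t * x i ^ r

/-- The numbers which admit a supersolution. -/
def feasibleSet (E : ι → Finset V) (r : ℕ) : Set ℝ :=
  {t | ∃ x, IsSupersolution E r t x}

variable {E : ι → Finset V} {r : ℕ}

lemma edgeSum_nonneg {x : V → ℝ} (hx : ∀ i, 0 ≤ x i) (i : V) : 0 ≤ edgeSum E x i :=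
  sum_nonneg fun _ _ => prod_nonneg fun k _ => hx k

lemma edgeSum_smul (hE : ∀ e, (E e).card = r) (c : ℝ) (x : V → ℝ) (i : V) :
    edgeSum E (c • x) i = c ^ r * edgeSum E x i := by
  simp [edgeSum, prod_mul_distrib, hE, mul_sum]

lemma edgeSum_mono {x y : V → ℝ} (hx : ∀ i, 0 ≤ x i) (hxy : ∀ i, x i ≤ y i) (i : V) :
    edgeSum E x i ≤ edgeSum E y i :=
  sum_le_sum fun _ _ => prod_le_prod (fun k _ => hx k) fun k _ => hxy k

lemma continuous_edgeSum (i : V) : Continuous fun x : V → ℝ => edgeSum E x i := by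
  unfold edgeSum
  fun_prop

lemma IsSupersolution.smul (hE : ∀ e, (E e).card = r) {t c : ℝ} {x : V → ℝ}
    (h : IsSupersolution E r t x) (hc : 0 < c) : IsSupersolution E r t (c • x) := by
  refine ⟨fun i => mul_pos hc (h.1 i), fun i => ?_⟩
  rw [edgeSum_smul hE, Pi.smul_apply, smul_eq_mul, mul_pow]
  nlinarith [mul_le_mul_of_nonneg_left (h.2 i) (pow_pos hc r).le]

lemma IsSupersolution.nonneg [Nonempty V] {t : ℝ} {x : V → ℝ} (h : IsSupersolution E r t x) :
    0 ≤ t := by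
  obtain ⟨i⟩ := ‹Nonempty V›
  have := (edgeSum_nonneg (E := E) (fun i => (h.1 i).le) i).trans (h.2 i)
  exact nonneg_of_mul_nonneg_left this (pow_pos (h.1 i) r)

/-- The Collatz–Wielandt bound. -/
lemma IsSupersolution.le_of_subsolution [Finite V] (hE : ∀ e, (E e).card = r) {t s : ℝ}
    {x y : V → ℝ}
    (h : IsSupersolution E r t x) (hy : ∀ i, 0 ≤ y i) (hy0 : ∃ i, y i ≠ 0)
    (hs : ∀ i, s * y i ^ r ≤ edgeSum E y i) : s ≤ t := by
  obtain ⟨i₀, hi₀⟩ := hy0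
  have : Nonempty V := ⟨i₀⟩
  -- Scale `x` until it touches `y` from above, and compare the two inequalities at the point of
  -- contact.
  obtain ⟨i, hi⟩ := Finite.exists_max fun i => y i / x i
  set c := y i / x i with hc
  have hle : ∀ k, y k ≤ (c • x) k := fun k => by
    have := hi k
    rwa [div_le_iff₀ (h.1 k)] at this
  have hyi : y i = c * x i := by rw [hc, div_mul_cancel₀ _ (h.1 i).ne']
  have hcpos : 0 < c := by
    have h0 : 0 < y i₀ := lt_of_le_of_ne (hy i₀) hi₀.symm
    exact lt_of_lt_of_le (div_pos h0 (h.1 i₀)) (hi i₀)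
  have h1 : s * y i ^ r ≤ t * y i ^ r := by
    calc s * y i ^ r ≤ edgeSum E y i := hs i
      _ ≤ edgeSum E (c • x) i := edgeSum_mono hy hle i
      _ = c ^ r * edgeSum E x i := edgeSum_smul hE c x i
      _ ≤ c ^ r * (t * x i ^ r) := mul_le_mul_of_nonneg_left (h.2 i) (pow_pos hcpos r).le
      _ = t * y i ^ r := by rw [hyi]; ring
  exact le_of_mul_le_mul_right h1 (pow_pos (hyi ▸ mul_pos hcpos (h.1 i)) r)

/-- A Harnack inequality: the values of a supersolution at adjacent vertices are comparable. -/
lemma IsSupersolution.le_mul_of_mem (hE : ∀ e, (E e).card = r) {t T : ℝ} {x : V → ℝ}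
    (h : IsSupersolution E r t x) (ht : t ≤ T) (hT : 0 ≤ T) {e : ι} {i j : V}
    (hi : i ∈ E e) (hj : j ∈ E e) : x j ≤ T * x i := by
  -- At the smallest value on the edge, `x j * x k ^ (r - 1) ≤ ∏ x ≤ t * x k ^ r`, so even the
  -- largest value is at most `t * x k`.
  obtain ⟨k, hk, hmin⟩ := exists_min_image (E e) x ⟨i, hi⟩
  have hr : r = r - 1 + 1 := by
    have : 0 < (E e).card := card_pos.2 ⟨i, hi⟩
    rw [hE] at this
    omega
  have h1 : ∏ l ∈ E e, x l ≤ t * x k ^ r := by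
    refine le_trans ?_ (h.2 k)
    exact single_le_sum (f := fun e => ∏ l ∈ E e, x l)
      (fun e _ => prod_nonneg fun l _ => (h.1 l).le) (by simpa using hk)
  have h2 : x j * x k ^ (r - 1) ≤ ∏ l ∈ E e, x l := by
    rw [← mul_prod_erase _ _ hj]
    refine mul_le_mul_of_nonneg_left ?_ (h.1 j).le
    rw [← hE e, ← card_erase_of_mem hj, ← prod_const]
    exact prod_le_prod (fun _ _ => (h.1 k).le) fun l hl => hmin l (mem_of_mem_erase hl)
  have h3 : x j * x k ^ (r - 1) ≤ t * x k * x k ^ (r - 1) := by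
    refine (h2.trans h1).trans_eq ?_
    conv_lhs => rw [hr, pow_succ]
    ring
  have h4 := le_of_mul_le_mul_right h3 (pow_pos (h.1 k) _)
  calc x j ≤ t * x k := h4
    _ ≤ T * x k := mul_le_mul_of_nonneg_right ht (h.1 k).le
    _ ≤ T * x i := mul_le_mul_of_nonneg_left (hmin i hi) hT

/-- Two vertices are adjacent if they lie in a common member of the family. -/
def Adj (E : ι → Finset V) (i j : V) : Prop := ∃ e, i ∈ E e ∧ j ∈ E e

/-- Chaining the Harnack inequality along a walk. The point is that `C` depends neither on `x` nor
on `t ≤ T`; this gives the compactness in `exists_isLeast_feasibleSet`. -/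
lemma exists_le_mul (hE : ∀ e, (E e).card = r) {T : ℝ} (hT : 0 < T) {i j : V}
    (hij : Relation.ReflTransGen (Adj E) i j) :
    ∃ C : ℝ, 0 < C ∧ ∀ t x, IsSupersolution E r t x → t ≤ T → x j ≤ C * x i ∧ x i ≤ C * x j := by
  induction hij with
  | refl => exact ⟨1, one_pos, fun t x _ _ => by simp⟩
  | @tail k l _ hkl ih =>
    obtain ⟨C, hC, h⟩ := ih
    obtain ⟨e, hk, hl⟩ := hkl
    refine ⟨T * C, by positivity, fun t x hx ht => ⟨?_, ?_⟩⟩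
    · have h1 := hx.le_mul_of_mem hE ht hT.le hk hl
      have h2 := (h t x hx ht).1
      nlinarith
    · have h1 := hx.le_mul_of_mem hE ht hT.le hl hk
      have h2 := (h t x hx ht).2
      nlinarith

lemma feasibleSet_nonempty : (feasibleSet E r).Nonempty := by
  refine ⟨Fintype.card ι, fun _ => 1, fun _ => one_pos, fun i => ?_⟩
  simp only [edgeSum, prod_const_one, sum_const, one_pow, mul_one, nsmul_eq_mul]
  exact_mod_cast card_filter_le _ _

lemma exists_isLeast_feasibleSet [Nonempty V] (hE : ∀ e, (E e).card = r)
    (hconn : ∀ i j, Relation.ReflTransGen (Adj E) i j) : ∃ t, IsLeast (feasibleSet E r) t := by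
  obtain ⟨i₀⟩ := ‹Nonempty V›
  have : Nonempty V := ⟨i₀⟩
  obtain ⟨T₀, hT₀⟩ := feasibleSet_nonempty (E := E) (r := r)
  set T := max T₀ 1
  have hT : 0 < T := lt_of_lt_of_le one_pos (le_max_right _ _)
  choose C hC hCle using fun j => exists_le_mul hE hT (hconn i₀ j)
  -- Supersolutions can be normalized to have value `1` at `i₀`; they then stay in a box bounded
  -- away from `0`, so the infimum of `t` is attained on a compact set.
  let K : Set (ℝ × (V → ℝ)) := (Set.Icc 0 T ×ˢ Set.Icc (fun j => (C j)⁻¹) C) ∩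
    ⋂ i, {p | edgeSum E p.2 i ≤ p.1 * p.2 i ^ r}
  have hK : IsCompact K := by
    refine (isCompact_Icc.prod isCompact_Icc).inter_right (isClosed_iInter fun i => ?_)
    exact isClosed_le ((continuous_edgeSum i).comp continuous_snd) (by fun_prop)
  have key : ∀ t ∈ feasibleSet E r, t ≤ T → ∃ x, (t, x) ∈ K := by
    rintro t ⟨x, hx⟩ htT
    have hy := hx.smul hE (inv_pos.2 (hx.1 i₀))
    set y := (x i₀)⁻¹ • x with hydef
    have hy0 : y i₀ = 1 := by simp [hydef, (hx.1 i₀).ne']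
    refine ⟨y, ⟨⟨hx.nonneg, htT⟩, fun j => ?_, fun j => ?_⟩, Set.mem_iInter.2 hy.2⟩
    · have := (hCle j t y hy htT).2
      rw [hy0] at this
      exact (inv_le_iff_one_le_mul₀' (hC j)).2 this
    · simpa [hy0] using (hCle j t y hy htT).1
  obtain ⟨x₀, hx₀⟩ := key T ⟨hT₀.choose, hT₀.choose_spec.1, fun i =>
    (hT₀.choose_spec.2 i).trans (mul_le_mul_of_nonneg_right (le_max_left _ _)
      (pow_pos (hT₀.choose_spec.1 i) r).le)⟩ le_rfl
  obtain ⟨⟨t, x⟩, hmem, hmin⟩ := hK.exists_isMinOn ⟨_, hx₀⟩ continuous_fst.continuousOn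
  refine ⟨t, ⟨x, fun i => lt_of_lt_of_le (inv_pos.2 (hC i)) (hmem.1.2.1 i),
    Set.mem_iInter.1 hmem.2⟩, fun s hs => ?_⟩
  by_cases hsT : s ≤ T
  · obtain ⟨y, hy⟩ := key s hs hsT
    exact hmin hy
  · exact hmem.1.1.2.trans (not_le.1 hsT).le

/-- If a supersolution is strict at `i`, but not at the adjacent vertex `j`, then there is one
which is strict at more vertices. -/
lemma IsSupersolution.exists_strict_ssubset {t : ℝ} {x : V → ℝ} (h : IsSupersolution E r t x)
    {i j : V} (hi : edgeSum E x i < t * x i ^ r) (hj : ¬ edgeSum E x j < t * x j ^ r)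
    (hij : Adj E i j) :
    ∃ y, IsSupersolution E r t y ∧
      {k | edgeSum E x k < t * x k ^ r} ⊂ {k | edgeSum E y k < t * y k ^ r} := by
  have hne : j ≠ i := by rintro rfl; exact hj hi
  obtain ⟨e, hie, hje⟩ := hij
  -- Lowering the value at `i` slightly keeps the inequality there strict, raises no edge sum, and
  -- strictly lowers the one at `j` because of the common edge.
  obtain ⟨c, hc0, hcx, hc⟩ : ∃ c, 0 < c ∧ c < x i ∧ edgeSum E x i < t * c ^ r := by
    have hcont : Filter.Tendsto (fun c : ℝ => t * c ^ r) (nhdsWithin (x i) (Set.Iio (x i)))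
        (nhds (t * x i ^ r)) :=
      ((continuous_const.mul (continuous_id.pow r)).tendsto (x i)).mono_left nhdsWithin_le_nhds
    have h1 := hcont.eventually (lt_mem_nhds hi)
    have h2 : ∀ᶠ c in nhdsWithin (x i) (Set.Iio (x i)), 0 < c :=
      nhdsWithin_le_nhds (lt_mem_nhds (h.1 i))
    obtain ⟨c, ⟨h1, h2⟩, h3⟩ := ((h1.and h2).and self_mem_nhdsWithin).exists
    exact ⟨c, h2, h3, h1⟩
  set y := Function.update x i c with hy
  have hyi : y i = c := by simp [hy]
  have hyk : ∀ k, k ≠ i → y k = x k := fun k hk => by simp [hy, hk]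
  have hypos : ∀ k, 0 < y k := fun k => by
    by_cases hk : k = i
    · rw [hk, hyi]; exact hc0
    · rw [hyk k hk]; exact h.1 k
  have hyx : ∀ k, y k ≤ x k := fun k => by
    by_cases hk : k = i
    · rw [hk, hyi]; exact hcx.le
    · rw [hyk k hk]
  have hsum : ∀ k, edgeSum E y k ≤ edgeSum E x k := edgeSum_mono (fun k => (hypos k).le) hyx
  have hstrict : ∀ k, edgeSum E x k < t * x k ^ r → edgeSum E y k < t * y k ^ r := fun k hk => by
    by_cases hki : k = i
    · rw [hki, hyi]; exact (hsum i).trans_lt hc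
    · rw [hyk k hki]; exact (hsum k).trans_lt hk
  have hyj : edgeSum E y j < t * y j ^ r := by
    rw [hyk j hne]
    refine lt_of_lt_of_le ?_ (h.2 j)
    refine sum_lt_sum (fun f _ => prod_le_prod (fun k _ => (hypos k).le) fun k _ => hyx k)
      ⟨e, by simpa using hje, ?_⟩
    exact prod_lt_prod (fun k _ => hypos k) (fun k _ => hyx k) ⟨i, hie, by rw [hyi]; exact hcx⟩
  refine ⟨y, ⟨hypos, fun k => ?_⟩, ?_⟩
  · by_cases hki : k = i
    · rw [hki]; exact (hstrict i hi).le
    · rw [hyk k hki]; exact (hsum k).trans (h.2 k)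
  · exact (Set.ssubset_iff_of_subset fun k hk => hstrict k hk).2 ⟨j, hyj, hj⟩

/-- A form of the Perron–Frobenius theorem: the least feasible number has a positive
eigenvector. -/
lemma exists_edgeSum_eq [Finite V] [Nonempty V]
    (hconn : ∀ i j, Relation.ReflTransGen (Adj E) i j) {t : ℝ}
    (ht : IsLeast (feasibleSet E r) t) :
    ∃ x : V → ℝ, (∀ i, 0 < x i) ∧ ∀ i, edgeSum E x i = t * x i ^ r := by
  let strict (x : V → ℝ) : Set V := {k | edgeSum E x k < t * x k ^ r}
  obtain ⟨x₀, hx₀⟩ := ht.1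
  -- A supersolution whose set of strict vertices is maximal: this set is closed under adjacency, so
  -- by connectedness it is empty or everything.
  obtain ⟨s, hs⟩ := (Set.toFinite (strict '' {x | IsSupersolution E r t x})).exists_maximal
    ⟨_, x₀, hx₀, rfl⟩
  obtain ⟨x, hx, rfl⟩ := hs.1
  have hclosed : ∀ i ∈ strict x, ∀ j, Adj E i j → j ∈ strict x := fun i hi j hij => by
    by_contra hj
    obtain ⟨y, hy, hlt⟩ := IsSupersolution.exists_strict_ssubset hx hi hj hij
    exact hlt.2 (hs.2 ⟨y, hy, rfl⟩ hlt.1)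
  refine ⟨x, hx.1, fun i => (hx.2 i).antisymm ?_⟩
  by_contra hlt
  have hall : ∀ j, j ∈ strict x := fun j => by
    induction hconn i j with
    | refl => exact not_le.1 hlt
    | tail _ hkl ih => exact hclosed _ ih _ hkl
  -- If all inequalities were strict, the largest quotient would be a feasible number below `t`.
  obtain ⟨k, hk⟩ := Finite.exists_max fun k => edgeSum E x k / x k ^ r
  have h1 : edgeSum E x k / x k ^ r ∈ feasibleSet E r :=
    ⟨x, hx.1, fun j => (div_le_iff₀ (pow_pos (hx.1 j) r)).1 (hk j)⟩
  have h2 : edgeSum E x k / x k ^ r < t := (div_lt_iff₀ (pow_pos (hx.1 k) r)).2 (hall k)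
  exact absurd (ht.2 h1) (not_le.2 h2)

end SetFamily

/-! ### Eigenvalues of the adjacency tensor and the least feasible number. -/

namespace Hypergraph

open Finset

section Tensor

variable {α ι : Type*} {H : Hypergraph α} {m : ℕ}

/-- By cardinality such a `g` must enumerate `S \ {i}` bijectively; the count cancels the factor `1
/ m!` in the adjacency tensor. -/
lemma card_filter_image_cons {V : Type*} [Fintype V] [DecidableEq V] {S : Finset V} {i : V}
    (hS : S.card = m + 1) (hi : i ∈ S) :
    (univ.filter fun g : Fin m → V => univ.image (Fin.cons i g : Fin (m + 1) → V) = S).card =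
      m.factorial := by
  have hcard : Fintype.card (S.erase i) = m := by
    rw [Fintype.card_coe, card_erase_of_mem hi, hS, Nat.add_sub_cancel]
  have h1 : Fintype.card (Fin m ≃ S.erase i) = m.factorial := by
    rw [Fintype.card_equiv (Fintype.equivFinOfCardEq hcard).symm, Fintype.card_fin]
  rw [← h1, ← card_univ, eq_comm]
  refine card_bij (fun f _ j => (f j : V)) (fun f _ => ?_) (fun f _ f' _ h => ?_) fun g hg => ?_
  · simp only [mem_filter, mem_univ, true_and]
    ext k
    simp only [mem_image, mem_univ, true_and, Fin.exists_fin_succ, Fin.cons_zero, Fin.cons_succ]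
    constructor
    · rintro (rfl | ⟨j, rfl⟩)
      · exact hi
      · exact mem_of_mem_erase (f j).2
    · intro hk
      by_cases hki : k = i
      · exact Or.inl hki.symm
      · exact Or.inr ⟨f.symm ⟨k, mem_erase.2 ⟨hki, hk⟩⟩, by simp⟩
  · ext j
    exact congrFun h j
  · simp only [mem_filter, mem_univ, true_and] at hg
    have hinj : Function.Injective (Fin.cons i g : Fin (m + 1) → V) := by
      rw [← Set.injOn_univ, ← coe_univ, ← card_image_iff, hg, hS, card_univ, Fintype.card_fin]
    have hmem : ∀ j, g j ∈ S.erase i := fun j => by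
      refine mem_erase.2 ⟨fun h => ?_, ?_⟩
      · exact Fin.succ_ne_zero j (hinj (by simpa using h))
      · rw [← hg]
        exact mem_image.2 ⟨j.succ, mem_univ _, by simp⟩
    refine ⟨Equiv.ofBijective (fun j => ⟨g j, hmem j⟩)
      ((Fintype.bijective_iff_injective_and_card _).2 ⟨fun j j' h => ?_,
        by rw [hcard, Fintype.card_fin]⟩),
      mem_univ _, by ext; simp⟩
    have := congrArg Subtype.val h
    exact Fin.succ_injective _ (hinj (by simpa using this))

/-- The extra factor `x i` completes each monomial to the product over a whole edge, which turns the
eigenvalue equation into one for edge sums. -/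
lemma mul_tensorApply_adjacencyTensor [Fintype H.vertexSet] [DecidableEq H.vertexSet] [Fintype ι]
    {E : ι → Finset H.vertexSet} (hE : ∀ e, (E e).card = m + 1) (hinj : Function.Injective E)
    (hrange : H.edgeSet = Set.range fun e => Subtype.val '' (E e : Set H.vertexSet))
    (x : H.vertexSet → ℂ) (i : H.vertexSet) :
    x i * tensorApply (H.adjacencyTensor m) x i = ∑ e with i ∈ E e, ∏ k ∈ E e, x k := by
  have hentry : ∀ f : Fin (m + 1) → H.vertexSet, H.adjacencyTensor m f =
      ∑ e, if univ.image f = E e then 1 / (m.factorial : ℂ) else 0 := fun f => by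
    have hiff : ∀ e, Set.range (fun j => (f j : α)) = Subtype.val '' (E e : Set H.vertexSet) ↔
        univ.image f = E e := fun e => by
      rw [Set.range_comp' Subtype.val f, (Set.image_injective.2 Subtype.val_injective).eq_iff,
        ← coe_inj, coe_image, coe_univ, Set.image_univ]
    rw [adjacencyTensor, hrange]
    split_ifs with h
    · obtain ⟨e, he⟩ := h
      rw [sum_eq_single e, if_pos ((hiff e).1 he.symm)]
      · intro e' _ hne
        exact if_neg fun h' => hne (hinj (h'.symm.trans ((hiff e).1 he.symm)))
      · simp
    · refine (sum_eq_zero fun e _ => if_neg fun h' => h ⟨e, ((hiff e).2 h').symm⟩).symm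
  rw [tensorApply, finsum_eq_sum_of_fintype, mul_sum]
  simp_rw [hentry, sum_mul, mul_sum]
  rw [sum_comm, sum_filter]
  refine sum_congr rfl fun e _ => ?_
  have hterm : ∀ g : Fin m → H.vertexSet,
      x i * ((if univ.image (Fin.cons i g : Fin (m + 1) → H.vertexSet) = E e
        then 1 / (m.factorial : ℂ) else 0) * ∏ j, x (g j)) =
      if univ.image (Fin.cons i g : Fin (m + 1) → H.vertexSet) = E e
        then 1 / (m.factorial : ℂ) * ∏ k ∈ E e, x k else 0 := fun g => by
    split_ifs with h
    · have hprod : ∏ k ∈ E e, x k = x i * ∏ j, x (g j) := by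
        rw [← h, prod_image, Fin.prod_univ_succ]
        · simp
        · rw [← card_image_iff, h, hE, card_univ, Fintype.card_fin]
      rw [hprod]
      ring
    · ring
  simp_rw [hterm]
  rw [← sum_filter, sum_const, nsmul_eq_mul]
  split_ifs with hi
  · rw [card_filter_image_cons (hE e) hi]
    have : (m.factorial : ℂ) ≠ 0 := by exact_mod_cast m.factorial_ne_zero
    field_simp
  · rw [card_eq_zero.2, Nat.cast_zero, zero_mul]
    refine filter_eq_empty_iff.2 fun g _ h => hi ?_
    rw [← h]
    exact mem_image.2 ⟨0, mem_univ _, by simp⟩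

/-- The largest modulus of an eigenvalue of a connected uniform hypergraph is the least number
which admits a supersolution. -/
theorem isGreatest_eigenvalueModuli {r : ℕ} (hr : 1 ≤ r) [Fintype H.vertexSet]
    [DecidableEq H.vertexSet] [Fintype ι] (hH : H.IsConnected)
    {E : ι → Finset H.vertexSet} (hE : ∀ e, (E e).card = r) (hinj : Function.Injective E)
    (hrange : H.edgeSet = Set.range fun e => Subtype.val '' (E e : Set H.vertexSet)) :
    ∃ t, IsLeast (SetFamily.feasibleSet E r) t ∧ IsGreatest (H.eigenvalueModuli r) t := by
  obtain ⟨m, rfl⟩ : ∃ m, r = m + 1 := ⟨r - 1, by omega⟩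
  have : Nonempty H.vertexSet := hH.1.to_subtype
  have hadj : ∀ x y, H.Adj x y → ∀ hx : x ∈ H.vertexSet, ∃ hy : y ∈ H.vertexSet,
      SetFamily.Adj E ⟨x, hx⟩ ⟨y, hy⟩ := by
    rintro x y ⟨e, he, hxe, hye⟩ hx
    rw [hrange] at he
    obtain ⟨e, rfl⟩ := he
    obtain ⟨x, hxe, rfl⟩ := hxe
    obtain ⟨y, hye, rfl⟩ := hye
    exact ⟨y.2, e, hxe, hye⟩
  have hconn : ∀ i j, Relation.ReflTransGen (SetFamily.Adj E) i j := by
    rintro ⟨i, hi⟩ ⟨j, hj⟩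
    have key : ∀ k, Relation.ReflTransGen H.Adj i k → ∃ hk : k ∈ H.vertexSet,
        Relation.ReflTransGen (SetFamily.Adj E) ⟨i, hi⟩ ⟨k, hk⟩ := by
      intro k h
      induction h with
      | refl => exact ⟨hi, .refl⟩
      | tail _ hkl ih =>
        obtain ⟨hk, ih⟩ := ih
        obtain ⟨hl, h⟩ := hadj _ _ hkl hk
        exact ⟨hl, ih.tail h⟩
    exact (key j (hH.2 i hi j hj)).2
  obtain ⟨t, ht⟩ := SetFamily.exists_isLeast_feasibleSet hE hconn
  have ht0 : 0 ≤ t := ht.1.choose_spec.nonneg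
  refine ⟨t, ht, ?_, ?_⟩
  · obtain ⟨x, hx, hxt⟩ := SetFamily.exists_edgeSum_eq hconn ht
    refine ⟨t, ⟨fun i => (x i : ℂ), ?_, fun i => ?_⟩, by simp [abs_of_nonneg ht0]⟩
    · obtain ⟨i⟩ := ‹Nonempty H.vertexSet›
      intro h
      have := congrFun h i
      exact (hx i).ne' (by simpa using this)
    · have hne : (x i : ℂ) ≠ 0 := by exact_mod_cast (hx i).ne'
      refine mul_left_cancel₀ hne ?_
      refine (mul_tensorApply_adjacencyTensor hE hinj hrange (fun i => (x i : ℂ)) i).trans ?_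
      have := congrArg (fun z : ℝ => (z : ℂ)) (hxt i)
      simp only [SetFamily.edgeSum] at this
      push_cast at this
      rw [this, Nat.add_sub_cancel]
      ring
  · rintro _ ⟨μ, ⟨y, hy0, hy⟩, rfl⟩
    -- By the triangle inequality the moduli of an eigenvector form a subsolution for `‖μ‖`, to
    -- which the Collatz–Wielandt bound applies.
    obtain ⟨x, hx⟩ := ht.1
    obtain ⟨i, hi⟩ := Function.ne_iff.1 hy0
    refine hx.le_of_subsolution hE (y := fun i => ‖y i‖) (fun i => norm_nonneg _)
      ⟨i, by simpa using hi⟩ fun i => ?_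
    have h1 : ∑ e with i ∈ E e, ∏ k ∈ E e, y k = μ * y i ^ (m + 1) := by
      refine (mul_tensorApply_adjacencyTensor hE hinj hrange y i).symm.trans ?_
      refine (congrArg (y i * ·) (hy i)).trans ?_
      rw [Nat.add_sub_cancel]
      ring
    calc ‖μ‖ * ‖y i‖ ^ (m + 1) = ‖∑ e with i ∈ E e, ∏ k ∈ E e, y k‖ := by
          rw [h1, norm_mul, norm_pow]
      _ ≤ ∑ e with i ∈ E e, ‖∏ k ∈ E e, y k‖ := norm_sum_le _ _
      _ = SetFamily.edgeSum E (fun i => ‖y i‖) i := by simp [SetFamily.edgeSum, norm_prod]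

end Tensor

end Hypergraph

/-! ### Elimination of the vertices lying in only one edge. -/

namespace SetFamily

open Finset

variable {V ι S : Type*} [DecidableEq V]
  {E : ι → Finset V} {r : ℕ} {T : ι → Finset S} {v : S → V}

/-- The system of inequalities which remains of a supersolution when the vertices which lie in
only one member of the family are eliminated: `X p` is the `r`-th power of the value at `p`, and
`W i` is proportional to the product of the values over the `i`-th member. -/
structure IsReducedSolution [Fintype ι] [DecidableEq S] (T : ι → Finset S) (a : ℝ) (X : S → ℝ)
    (W : ι → ℝ) : Prop where
  vertex_pos : ∀ p, 0 < X p
  edge_pos : ∀ i, 0 < W i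
  prod_le : ∀ i, a * ∏ p ∈ T i, X p ≤ W i ^ (T i).card
  sum_le : ∀ p, ∑ i with p ∈ T i, W i ≤ X p

lemma filter_mem_range_eq_image (hv : ∀ i p, v p ∈ E i ↔ p ∈ T i) (i : ι)
    [DecidablePred (· ∈ Set.range v)] :
    {k ∈ E i | k ∈ Set.range v} = (T i).image v := by
  ext k
  simp only [mem_filter, mem_image]
  constructor
  · rintro ⟨hk, p, rfl⟩
    exact ⟨p, (hv i p).1 hk, rfl⟩
  · rintro ⟨p, hp, rfl⟩
    exact ⟨(hv i p).2 hp, p, rfl⟩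

open Classical in
lemma prod_eq_prod_mul_prod (hinj : Function.Injective v) (hv : ∀ i p, v p ∈ E i ↔ p ∈ T i)
    (f : V → ℝ) (i : ι) :
    ∏ k ∈ E i, f k = (∏ p ∈ T i, f (v p)) * ∏ k ∈ E i with k ∉ Set.range v, f k := by
  rw [← prod_filter_mul_prod_filter_not (E i) (· ∈ Set.range v),
    filter_mem_range_eq_image hv, prod_image hinj.injOn]

open Classical in
lemma card_add_card_filter (hinj : Function.Injective v) (hv : ∀ i p, v p ∈ E i ↔ p ∈ T i)
    (i : ι) : (T i).card + ({k ∈ E i | k ∉ Set.range v}).card = (E i).card := by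
  rw [← card_filter_add_card_filter_not (s := E i) (· ∈ Set.range v),
    filter_mem_range_eq_image hv, card_image_of_injective _ hinj]

variable [Fintype ι]

lemma edgeSum_of_notMem_range
    (hmeet : ∀ i j k, k ∈ E i → k ∈ E j → i ≠ j → k ∈ Set.range v) (x : V → ℝ) {k : V}
    (hk : k ∉ Set.range v) {i : ι} (hi : k ∈ E i) :
    edgeSum E x k = ∏ l ∈ E i, x l := by
  refine sum_eq_single_of_mem i (by simpa using hi) fun j hj hji => ?_
  exact absurd (hmeet j i k (by simpa using hj) hi hji) hk

variable [DecidableEq S]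

lemma edgeSum_vertex (hv : ∀ i p, v p ∈ E i ↔ p ∈ T i) (x : V → ℝ) (p : S) :
    edgeSum E x (v p) = ∑ i with p ∈ T i, ∏ l ∈ E i, x l := by
  simp [edgeSum, hv]

lemma IsSupersolution.exists_isReducedSolution (hE : ∀ e, (E e).card = r)
    (hinj : Function.Injective v) (hv : ∀ i p, v p ∈ E i ↔ p ∈ T i)
    (hmeet : ∀ i j k, k ∈ E i → k ∈ E j → i ≠ j → k ∈ Set.range v) {t : ℝ} (ht : 0 < t)
    {x : V → ℝ} (hx : IsSupersolution E r t x) :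
    ∃ X W, IsReducedSolution T (t ^ r)⁻¹ X W := by
  classical
  have hW : ∀ i, 0 < (∏ k ∈ E i, x k) / t := fun i => div_pos (prod_pos fun k _ => hx.1 k) ht
  refine ⟨fun p => x (v p) ^ r, fun i => (∏ k ∈ E i, x k) / t, fun p => pow_pos (hx.1 _) r, hW,
    fun i => ?_, fun p => ?_⟩
  · set w := (∏ k ∈ E i, x k) / t with hw
    have hcard := card_add_card_filter hinj hv i
    rw [hE] at hcard
    -- A vertex outside the range of `v` lies in no other edge, so its inequality reads `w ≤ x k ^
    -- r`. Inserting this into the `r`-th power of `∏ x = t * w` leaves only the factors at `T i`.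
    have h1 : w ^ ({k ∈ E i | k ∉ Set.range v}).card ≤
        ∏ k ∈ E i with k ∉ Set.range v, x k ^ r := by
      rw [← prod_const]
      refine prod_le_prod (fun _ _ => (hW i).le) fun k hk => ?_
      rw [mem_filter] at hk
      rw [hw, div_le_iff₀ ht, ← edgeSum_of_notMem_range hmeet x hk.2 hk.1, mul_comm]
      exact hx.2 k
    have h2 : t ^ r * w ^ r = (∏ p ∈ T i, x (v p) ^ r) *
        ∏ k ∈ E i with k ∉ Set.range v, x k ^ r := by
      rw [← prod_eq_prod_mul_prod hinj hv (fun k => x k ^ r), prod_pow, hw, div_pow,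
        mul_div_cancel₀ _ (pow_pos ht r).ne']
    have h3 : w ^ r = w ^ (T i).card * w ^ ({k ∈ E i | k ∉ Set.range v}).card := by
      rw [← pow_add, hcard]
    rw [inv_mul_le_iff₀ (pow_pos ht r)]
    refine le_of_mul_le_mul_right ?_ (pow_pos (hW i) ({k ∈ E i | k ∉ Set.range v}).card)
    rw [mul_assoc, ← hw, ← h3, h2]
    exact mul_le_mul_of_nonneg_left h1 (prod_nonneg fun p _ => (pow_pos (hx.1 _) r).le)
  · rw [← sum_div, div_le_iff₀ ht, ← edgeSum_vertex hv, mul_comm]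
    exact hx.2 _

lemma IsReducedSolution.exists_isSupersolution (hr : r ≠ 0) (hE : ∀ e, (E e).card = r)
    (hinj : Function.Injective v) (hv : ∀ i p, v p ∈ E i ↔ p ∈ T i)
    (hmeet : ∀ i j k, k ∈ E i → k ∈ E j → i ≠ j → k ∈ Set.range v) {t : ℝ} (ht : 0 < t)
    {X : S → ℝ} {W : ι → ℝ} (h : IsReducedSolution T (t ^ r)⁻¹ X W) :
    ∃ x, IsSupersolution E r t x := by
  classical
  -- `y` holds the `r`-th powers of the required values: a vertex private to edge `i` gets `W i`,
  -- the least value its own inequality allows. Vertices in no edge are unconstrained and get `1`.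
  obtain ⟨y, hy, hyX, hyW⟩ : ∃ y : V → ℝ, (∀ k, 0 < y k) ∧ (∀ p, y (v p) = X p) ∧
      ∀ k ∉ Set.range v, ∀ i, k ∈ E i → y k = W i := by
    refine ⟨fun k => if hk : k ∈ Set.range v then X hk.choose else
      if hi : ∃ i, k ∈ E i then W hi.choose else 1, fun k => ?_, fun p => ?_, fun k hk i hi => ?_⟩
    · dsimp only
      split_ifs
      exacts [h.vertex_pos _, h.edge_pos _, one_pos]
    · have hp : v p ∈ Set.range v := ⟨p, rfl⟩
      simp only [hp, dif_pos]
      rw [hinj hp.choose_spec]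
    · have hex : ∃ i, k ∈ E i := ⟨i, hi⟩
      simp only [hk, dif_neg, not_false_eq_true, hex, dif_pos]
      by_contra hne
      exact hk (hmeet _ _ k hex.choose_spec hi fun heq => hne (by rw [heq]))
  set x : V → ℝ := fun k => y k ^ (r : ℝ)⁻¹ with hxdef
  have hx : ∀ k, 0 < x k := fun k => Real.rpow_pos_of_pos (hy k) _
  have hxy : ∀ k, x k ^ r = y k := fun k => Real.rpow_inv_natCast_pow (hy k).le hr
  have hP : ∀ i, ∏ k ∈ E i, x k ≤ t * W i := fun i => by
    refine (pow_le_pow_iff_left₀ (prod_nonneg fun k _ => (hx k).le)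
      (mul_pos ht (h.edge_pos i)).le hr).1 ?_
    have hcard := card_add_card_filter hinj hv i
    rw [hE] at hcard
    have h1 : ∏ k ∈ E i with k ∉ Set.range v, y k =
        W i ^ ({k ∈ E i | k ∉ Set.range v}).card := by
      rw [← prod_const]
      refine prod_congr rfl fun k hk => ?_
      rw [mem_filter] at hk
      exact hyW k hk.2 i hk.1
    have h2 := (inv_mul_le_iff₀ (pow_pos ht r)).1 (h.prod_le i)
    rw [← prod_pow, prod_congr rfl fun k _ => hxy k, prod_eq_prod_mul_prod hinj hv y, h1,
      prod_congr rfl fun p _ => hyX p, mul_pow]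
    calc (∏ p ∈ T i, X p) * W i ^ ({k ∈ E i | k ∉ Set.range v}).card
        ≤ t ^ r * W i ^ (T i).card * W i ^ ({k ∈ E i | k ∉ Set.range v}).card :=
          mul_le_mul_of_nonneg_right h2 (pow_pos (h.edge_pos i) _).le
      _ = t ^ r * W i ^ r := by rw [mul_assoc, ← pow_add, hcard]
  refine ⟨x, hx, fun k => ?_⟩
  rw [hxy]
  by_cases hk : k ∈ Set.range v
  · obtain ⟨p, rfl⟩ := hk
    rw [edgeSum_vertex hv, hyX]
    calc ∑ i with p ∈ T i, ∏ l ∈ E i, x l ≤ ∑ i with p ∈ T i, t * W i :=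
          sum_le_sum fun i _ => hP i
      _ = t * ∑ i with p ∈ T i, W i := (mul_sum _ _ _).symm
      _ ≤ t * X p := mul_le_mul_of_nonneg_left (h.sum_le p) ht.le
  · by_cases hi : ∃ i, k ∈ E i
    · obtain ⟨i, hi⟩ := hi
      rw [edgeSum_of_notMem_range hmeet x hk hi, hyW k hk i hi]
      exact hP i
    · have : edgeSum E x k = 0 := by
        refine sum_eq_zero fun i hki => absurd ⟨i, by simpa using hki⟩ hi
      rw [this]
      exact (mul_pos ht (hy k)).le

lemma pos_of_mem_feasibleSet {t : ℝ} (ht : t ∈ feasibleSet E r) {i : ι}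
    (hi : (E i).Nonempty) : 0 < t := by
  obtain ⟨x, hx⟩ := ht
  obtain ⟨k, hk⟩ := hi
  have h1 : 0 < edgeSum E x k :=
    sum_pos (fun i _ => prod_pos fun k _ => hx.1 k) ⟨i, by simpa using hk⟩
  exact pos_of_mul_pos_left (h1.trans_le (hx.2 k)) (pow_pos (hx.1 k) r).le

/-- Existence of an edge forces `t > 0`, so `t` may be inverted. Afterwards the right-hand side
depends on the family only through the traces `T`. -/
lemma feasibleSet_eq [Nonempty ι] (hr : r ≠ 0) (hE : ∀ e, (E e).card = r)
    (hinj : Function.Injective v) (hv : ∀ i p, v p ∈ E i ↔ p ∈ T i)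
    (hmeet : ∀ i j k, k ∈ E i → k ∈ E j → i ≠ j → k ∈ Set.range v) :
    feasibleSet E r = {t | 0 < t ∧ ∃ X W, IsReducedSolution T (t ^ r)⁻¹ X W} := by
  obtain ⟨i⟩ := ‹Nonempty ι›
  have hi : (E i).Nonempty := card_ne_zero.1 (by rwa [hE])
  ext t
  constructor
  · intro ht
    have h0 := pos_of_mem_feasibleSet ht hi
    obtain ⟨x, hx⟩ := ht
    exact ⟨h0, hx.exists_isReducedSolution hE hinj hv hmeet h0⟩
  · rintro ⟨h0, X, W, h⟩
    exact h.exists_isSupersolution hr hE hinj hv hmeet h0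

end SetFamily

/-! ### Skeletons: spectral radius and matchings from edge traces. -/

namespace Hypergraph

/-- A description of an `r`-uniform hypergraph by the traces `T i` of its edges on a set of
vertices which contains all the vertices that lie in more than one edge. -/
structure Skeleton {α ι S : Type*} (H : Hypergraph α) (r : ℕ) (T : ι → Finset S) where
  /-- The vertices of the skeleton. -/
  vertex : S → α
  /-- The edges of the hypergraph. -/
  edge : ι → Set α
  vertex_injective : Function.Injective vertex
  vertex_mem : ∀ p, vertex p ∈ H.vertexSet
  edge_injective : Function.Injective edge
  range_edge : Set.range edge = H.edgeSet
  ncard_edge : ∀ i, (edge i).ncard = r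
  vertex_mem_edge_iff : ∀ i p, vertex p ∈ edge i ↔ p ∈ T i
  mem_range_of_mem_of_mem : ∀ i j x, x ∈ edge i → x ∈ edge j → i ≠ j → x ∈ Set.range vertex

namespace Skeleton

variable {α ι S : Type*} {H : Hypergraph α} {r : ℕ} {T : ι → Finset S}

lemma edge_mem (K : Skeleton H r T) (i : ι) : K.edge i ∈ H.edgeSet :=
  K.range_edge ▸ Set.mem_range_self i

open SetFamily in
/-- The spectral radius of a connected hypergraph in terms of a skeleton. -/
theorem exists_isLeast_isGreatest [Fintype ι] [Nonempty ι] [DecidableEq S]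
    (K : Skeleton H r T) (hr : 1 ≤ r)
    (hfin : H.vertexSet.Finite) (hH : H.IsConnected) :
    ∃ t, IsLeast {t : ℝ | 0 < t ∧ ∃ X W, IsReducedSolution T (t ^ r)⁻¹ X W} t ∧
      IsGreatest (H.eigenvalueModuli r) t := by
  classical
  have : Fintype H.vertexSet := hfin.fintype
  let E : ι → Finset H.vertexSet := fun i => Finset.univ.filter fun k => (k : α) ∈ K.edge i
  have hmem : ∀ i k, k ∈ E i ↔ (k : α) ∈ K.edge i := fun i k => by simp [E]
  have himage : ∀ i, Subtype.val '' (E i : Set H.vertexSet) = K.edge i := fun i => by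
    ext k
    constructor
    · rintro ⟨k, hk, rfl⟩
      exact (hmem i k).1 hk
    · intro hk
      have hkV := mem_vertexSet_of_mem_edgeSet (K.edge_mem i) hk
      exact ⟨⟨k, hkV⟩, (hmem i _).2 hk, rfl⟩
  have hcard : ∀ i, (E i).card = r := fun i => by
    rw [← K.ncard_edge i, ← himage, Set.ncard_image_of_injective _ Subtype.val_injective,
      Set.ncard_coe_finset]
  obtain ⟨t, ht, ht'⟩ := isGreatest_eigenvalueModuli hr hH hcard
    (fun i j hij => K.edge_injective (by rw [← himage, ← himage, hij]))
    (by simp_rw [himage]; exact K.range_edge.symm)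
  rw [feasibleSet_eq (v := fun p => ⟨K.vertex p, K.vertex_mem p⟩) (T := T) (by omega) hcard
    (fun p q hpq => K.vertex_injective (congrArg Subtype.val hpq))
    (fun i p => (hmem i _).trans (K.vertex_mem_edge_iff i p))] at ht
  · exact ⟨t, ht, ht'⟩
  · intro i j k hi hj hij
    obtain ⟨p, hp⟩ := K.mem_range_of_mem_of_mem i j k ((hmem i k).1 hi) ((hmem j k).1 hj) hij
    exact ⟨p, Subtype.ext hp⟩

/-- The matchings of a hypergraph in terms of a skeleton. -/
theorem numMatchings_eq [Fintype ι] [DecidableEq S] (K : Skeleton H r T) (k : ℕ) :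
    H.numMatchings k =
      {A : Finset ι | A.card = k ∧ ∀ i ∈ A, ∀ j ∈ A, i ≠ j → Disjoint (T i) (T j)}.ncard := by
  -- Distinct edges meet only in skeleton vertices, so their disjointness can be read off from the
  -- traces.
  have hdisj : ∀ i j, i ≠ j → (Disjoint (K.edge i) (K.edge j) ↔ Disjoint (T i) (T j)) := by
    intro i j hij
    rw [Set.disjoint_left, Finset.disjoint_left]
    constructor
    · intro h p hi hj
      exact h ((K.vertex_mem_edge_iff i p).2 hi) ((K.vertex_mem_edge_iff j p).2 hj)
    · intro h x hi hj
      obtain ⟨p, rfl⟩ := K.mem_range_of_mem_of_mem i j x hi hj hij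
      exact h ((K.vertex_mem_edge_iff i p).1 hi) ((K.vertex_mem_edge_iff j p).1 hj)
  have hpair : ∀ A : Finset ι, (K.edge '' (A : Set ι)).PairwiseDisjoint id ↔
      ∀ i ∈ A, ∀ j ∈ A, i ≠ j → Disjoint (T i) (T j) := fun A => by
    rw [Set.InjOn.pairwiseDisjoint_image K.edge_injective.injOn]
    constructor
    · intro h i hi j hj hij
      exact (hdisj i j hij).1 (h hi hj hij)
    · intro h i hi j hj hij
      exact (hdisj i j hij).2 (h i hi j hj hij)
  rw [numMatchings, eq_comm, ← Set.ncard_image_of_injective (f := fun A : Finset ι =>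
    K.edge '' (A : Set ι)) _ fun A B hAB =>
      Finset.coe_injective (K.edge_injective.image_injective hAB)]
  congr 1
  ext M
  constructor
  · rintro ⟨A, ⟨hA, hA'⟩, rfl⟩
    refine ⟨?_, ?_, (hpair A).2 hA'⟩
    · rintro _ ⟨i, _, rfl⟩
      exact K.edge_mem i
    · rw [Set.ncard_image_of_injective _ K.edge_injective, Set.ncard_coe_finset, hA]
  · rintro ⟨hM, hM', hM''⟩
    obtain ⟨B, rfl⟩ := Set.subset_range_iff_exists_image_eq.1 (hM.trans_eq K.range_edge.symm)
    obtain ⟨A, rfl⟩ := (Set.toFinite B).exists_finset_coe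
    refine ⟨A, ⟨?_, (hpair A).1 hM''⟩, rfl⟩
    rwa [Set.ncard_image_of_injective _ K.edge_injective, Set.ncard_coe_finset] at hM'

end Skeleton

end Hypergraph

/-! ### Gluing of hypergraphs and of skeletons. -/

namespace Hypergraph

open Function

section Glue

variable {α β : Type*} {G : Hypergraph α} {u : α} {Γ : Hypergraph β} {w : β}

open Classical in
/-- The embedding of the second factor into a glued hypergraph. -/
noncomputable abbrev glueMap (u : α) (w : β) : β → α ⊕ β := update Sum.inr w (Sum.inl u)

lemma glueMap_self : glueMap u w w = Sum.inl u := by simp [glueMap]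

lemma glueMap_of_ne {b : β} (h : b ≠ w) : glueMap u w b = Sum.inr b := by simp [glueMap, h]

lemma glueMap_eq_inl {b : β} {a : α} : glueMap u w b = Sum.inl a ↔ b = w ∧ a = u := by
  by_cases h : b = w
  · subst h
    simp [eq_comm]
  · simp [h]

lemma glueMap_eq_inr {b b' : β} : glueMap u w b = Sum.inr b' ↔ b = b' ∧ b' ≠ w := by
  by_cases h : b = w
  · subst h
    simpa [glueMap_self] using fun h => h.symm
  · rw [glueMap_of_ne h, Sum.inr.injEq]
    exact ⟨fun hb => ⟨hb, hb ▸ h⟩, And.left⟩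

lemma glueMap_injective : Injective (glueMap u w) := by
  intro b b' h
  rcases hb : glueMap u w b' with a | c
  · rw [hb] at h
    rw [(glueMap_eq_inl.1 h).1, (glueMap_eq_inl.1 hb).1]
  · rw [hb] at h
    rw [(glueMap_eq_inr.1 h).1, (glueMap_eq_inr.1 hb).1]

lemma vertexSet_glue :
    (G.glue u Γ w).vertexSet = Sum.inl '' G.vertexSet ∪ glueMap u w '' Γ.vertexSet := rfl

lemma edgeSet_glue :
    (G.glue u Γ w).edgeSet =
      Set.image Sum.inl '' G.edgeSet ∪ Set.image (glueMap u w) '' Γ.edgeSet := rfl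

lemma finite_vertexSet_glue (hG : G.vertexSet.Finite) (hΓ : Γ.vertexSet.Finite) :
    (G.glue u Γ w).vertexSet.Finite := (hG.image _).union (hΓ.image _)

lemma ncard_vertexSet_glue (hG : G.vertexSet.Finite) (hΓ : Γ.vertexSet.Finite)
    (hu : u ∈ G.vertexSet) :
    (G.glue u Γ w).vertexSet.ncard = G.vertexSet.ncard + (Γ.vertexSet \ {w}).ncard := by
  have h : (G.glue u Γ w).vertexSet =
      Sum.inl '' G.vertexSet ∪ Sum.inr '' (Γ.vertexSet \ {w}) := by
    rw [vertexSet_glue]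
    ext (a | b)
    · simp only [Set.mem_union, Set.mem_image, glueMap_eq_inl]
      grind
    · simp only [Set.mem_union, Set.mem_image, glueMap_eq_inr]
      grind
  rw [h, Set.ncard_union_eq _ (hG.image _) (hΓ.sdiff.image _),
    Set.ncard_image_of_injective _ Sum.inl_injective,
    Set.ncard_image_of_injective _ Sum.inr_injective]
  rw [Set.disjoint_left]
  rintro _ ⟨a, _, rfl⟩ ⟨b, _, h⟩
  cases h

lemma isConnected_of_forall_reflTransGen {x : α} (hx : x ∈ G.vertexSet)
    (h : ∀ y ∈ G.vertexSet, Relation.ReflTransGen G.Adj x y) : G.IsConnected := by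
  refine ⟨⟨x, hx⟩, fun y hy z hz => ?_⟩
  have : Std.Symm G.Adj := ⟨fun _ _ h => h.symm⟩
  exact (Relation.ReflTransGen.stdSymm.symm _ _ (h y hy)).trans (h z hz)

lemma IsConnected.glue (hG : G.IsConnected) (hΓ : Γ.IsConnected) (hu : u ∈ G.vertexSet)
    (hw : w ∈ Γ.vertexSet) : (G.glue u Γ w).IsConnected := by
  refine isConnected_of_forall_reflTransGen (x := Sum.inl u) (Or.inl ⟨u, hu, rfl⟩) ?_
  rintro _ (⟨a, ha, rfl⟩ | ⟨b, hb, rfl⟩)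
  · refine (hG.2 u hu a ha).lift Sum.inl ?_
    rintro x y ⟨e, he, hx, hy⟩
    exact ⟨_, Or.inl ⟨e, he, rfl⟩, Set.mem_image_of_mem _ hx, Set.mem_image_of_mem _ hy⟩
  · change Relation.ReflTransGen _ _ (glueMap u w b)
    rw [← glueMap_self (u := u) (w := w)]
    refine (hΓ.2 w hw b hb).lift (glueMap u w) ?_
    rintro x y ⟨e, he, hx, hy⟩
    exact ⟨_, Or.inr ⟨e, he, rfl⟩, Set.mem_image_of_mem _ hx, Set.mem_image_of_mem _ hy⟩

end Glue

namespace Skeleton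

open Finset

/-- The traces of the edges of a glued hypergraph, where the vertex `p` of the first skeleton is
identified with the vertex `none` of the second one. -/
def glueTrace {ι κ S S' : Type*} [DecidableEq S] [DecidableEq S'] (T : ι → Finset S) (p : S)
    (T' : κ → Finset (Option S')) : ι ⊕ κ → Finset (S ⊕ S') :=
  Sum.elim (fun i => (T i).image Sum.inl)
    fun k => (T' k).image fun o => o.elim (Sum.inl p) Sum.inr

variable {α β ι κ S S' : Type*} [DecidableEq S] [DecidableEq S'] {G : Hypergraph α}
  {Γ : Hypergraph β} {r : ℕ} {T : ι → Finset S} {T' : κ → Finset (Option S')} {p q : S} {o : S'}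
  {i : ι} {k : κ}

@[simp] lemma inl_mem_glueTrace_inl : Sum.inl q ∈ glueTrace T p T' (Sum.inl i) ↔ q ∈ T i := by
  simp [glueTrace]

@[simp] lemma inr_mem_glueTrace_inl : Sum.inr o ∈ glueTrace T p T' (Sum.inl i) ↔ False := by
  simp [glueTrace]

@[simp] lemma inl_mem_glueTrace_inr :
    Sum.inl q ∈ glueTrace T p T' (Sum.inr k) ↔ q = p ∧ none ∈ T' k := by
  simp only [glueTrace, Sum.elim_inr, mem_image, Option.exists]
  simp [eq_comm, and_comm]

@[simp] lemma inr_mem_glueTrace_inr :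
    Sum.inr o ∈ glueTrace T p T' (Sum.inr k) ↔ some o ∈ T' k := by
  simp [glueTrace, Option.exists]

/-- The skeleton of a glued hypergraph. -/
noncomputable def glue (hr : 2 ≤ r) (K : Skeleton G r T) (L : Skeleton Γ r T') (p : S) :
    Skeleton (G.glue (K.vertex p) Γ (L.vertex none)) r (glueTrace T p T') where
  vertex := Sum.elim (Sum.inl ∘ K.vertex) (Sum.inr ∘ L.vertex ∘ some)
  edge := Sum.elim (fun i => Sum.inl '' K.edge i)
    fun k => glueMap (K.vertex p) (L.vertex none) '' L.edge k
  vertex_injective := by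
    refine Function.Injective.sumElim (Sum.inl_injective.comp K.vertex_injective)
      (Sum.inr_injective.comp (L.vertex_injective.comp (Option.some_injective _))) ?_
    simp
  vertex_mem := by
    rintro (q | o)
    · exact Or.inl ⟨_, K.vertex_mem q, rfl⟩
    · exact Or.inr ⟨_, L.vertex_mem (some o),
        glueMap_of_ne (L.vertex_injective.ne (Option.some_ne_none o))⟩
  edge_injective := by
    refine Function.Injective.sumElim (Sum.inl_injective.image_injective.comp K.edge_injective)
      (glueMap_injective.image_injective.comp L.edge_injective) fun i k h => ?_
    -- The two copies share only the glued vertex, so an edge common to both would have at most one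
    -- vertex, against `2 ≤ r`.
    have hsub : L.edge k ⊆ {L.vertex none} := fun b hb => by
      have hb' := Set.mem_image_of_mem (glueMap (K.vertex p) (L.vertex none)) hb
      rw [← h] at hb'
      obtain ⟨a, _, ha⟩ := hb'
      exact (glueMap_eq_inl.1 ha.symm).1
    have := Set.ncard_le_ncard hsub
    rw [L.ncard_edge, Set.ncard_singleton] at this
    omega
  range_edge := by
    rw [Set.Sum.elim_range, edgeSet_glue, ← K.range_edge, ← L.range_edge, ← Set.range_comp,
      ← Set.range_comp]
    rfl
  ncard_edge := by
    rintro (i | k)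
    · exact (Set.ncard_image_of_injective _ Sum.inl_injective).trans (K.ncard_edge i)
    · exact (Set.ncard_image_of_injective _ glueMap_injective).trans (L.ncard_edge k)
  vertex_mem_edge_iff := by
    rintro (i | k) (q | o)
    · simpa using K.vertex_mem_edge_iff i q
    · simp
    · simp only [Sum.elim_inl, Sum.elim_inr, Function.comp_apply, inl_mem_glueTrace_inr,
        Set.mem_image, glueMap_eq_inl, K.vertex_injective.eq_iff, ← L.vertex_mem_edge_iff]
      grind
    · simp only [Sum.elim_inr, Function.comp_apply, inr_mem_glueTrace_inr, Set.mem_image,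
        glueMap_eq_inr, ← L.vertex_mem_edge_iff]
      have := L.vertex_injective.ne (Option.some_ne_none o)
      grind
  mem_range_of_mem_of_mem := by
    have hmixed : ∀ i k x, x ∈ Sum.inl '' K.edge i →
        x ∈ glueMap (K.vertex p) (L.vertex none) '' L.edge k → x = Sum.inl (K.vertex p) := by
      rintro i k _ ⟨a, _, rfl⟩ ⟨b, _, hb⟩
      rw [(glueMap_eq_inl.1 hb).2]
    rintro (i | k) (j | l) x hi hj hne
    · obtain ⟨a, ha, rfl⟩ := hi
      obtain ⟨a', ha', h⟩ := hj
      obtain rfl := Sum.inl_injective h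
      obtain ⟨q, rfl⟩ := K.mem_range_of_mem_of_mem i j _ ha ha' fun h => hne (by rw [h])
      exact ⟨Sum.inl q, rfl⟩
    · exact ⟨Sum.inl p, (hmixed _ _ _ hi hj).symm⟩
    · exact ⟨Sum.inl p, (hmixed _ _ _ hj hi).symm⟩
    · obtain ⟨b, hb, rfl⟩ := hi
      obtain ⟨b', hb', h⟩ := hj
      obtain rfl := glueMap_injective h
      obtain ⟨o, rfl⟩ := L.mem_range_of_mem_of_mem k l _ hb hb' fun h => hne (by rw [h])
      cases o with
      | none => exact ⟨Sum.inl p, glueMap_self.symm⟩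
      | some o =>
        exact ⟨Sum.inr o, (glueMap_of_ne (L.vertex_injective.ne (Option.some_ne_none o))).symm⟩

/-- The skeleton of a loose path consisting of the path vertices. -/
def loosePath (hr : 2 ≤ r) (t : ℕ) :
    Skeleton (loosePath r t) r fun i : Fin t => {i.castSucc, i.succ} where
  vertex := Sum.inl
  edge i := {Sum.inl i.castSucc, Sum.inl i.succ} ∪ Set.range fun j : Fin (r - 2) => Sum.inr (i, j)
  vertex_injective := Sum.inl_injective
  vertex_mem _ := Set.mem_univ _
  edge_injective i j h := by
    have h1 : Sum.inl i.castSucc ∈ ({Sum.inl i.castSucc, Sum.inl i.succ} ∪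
      Set.range fun k : Fin (r - 2) => Sum.inr (i, k) : Set (PathVertex r t)) := by simp
    have h2 : Sum.inl i.succ ∈ ({Sum.inl i.castSucc, Sum.inl i.succ} ∪
      Set.range fun k : Fin (r - 2) => Sum.inr (i, k) : Set (PathVertex r t)) := by simp
    simp only at h
    rw [h] at h1 h2
    simp only [Set.mem_union, Set.mem_insert_iff, Set.mem_singleton_iff, Set.mem_range,
      Sum.inl.injEq, reduceCtorEq, exists_false, or_false, Fin.ext_iff, Fin.val_castSucc,
      Fin.val_succ] at h1 h2
    ext
    omega
  range_edge := rfl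
  ncard_edge i := by
    rw [Set.ncard_union_eq _ (Set.toFinite _) (Set.toFinite _), Set.ncard_pair,
      ← Set.image_univ, Set.ncard_image_of_injective, Set.ncard_univ, Nat.card_fin]
    · omega
    · intro j k h
      simpa using h
    · rw [Ne, Sum.inl.injEq]
      exact Fin.castSucc_lt_succ.ne
    · rw [Set.disjoint_left]
      rintro x (rfl | rfl) ⟨j, hj⟩ <;> cases hj
  vertex_mem_edge_iff i p := by simp
  mem_range_of_mem_of_mem i j x hi hj hij := by
    rcases x with p | ⟨k, l⟩
    · exact ⟨p, rfl⟩
    · simp only [Set.mem_union, Set.mem_insert_iff, reduceCtorEq, Set.mem_singleton_iff,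
        Set.mem_range, Sum.inr.injEq, Prod.mk.injEq, false_or] at hi hj
      grind

/-- The skeleton of a single edge consisting of the vertex `none` and of given other vertices. -/
def singleEdge [Fintype S'] (hr : 1 ≤ r) (g : S' ↪ Fin (r - 1)) :
    Skeleton (singleEdge r) r fun _ : Unit => (univ : Finset (Option S')) where
  vertex := Option.map g
  edge _ := Set.univ
  vertex_injective := Option.map_injective g.injective
  vertex_mem _ := Set.mem_univ _
  edge_injective := injective_of_subsingleton _
  range_edge := by simp [Hypergraph.singleEdge]
  ncard_edge _ := by
    rw [Set.ncard_univ, Nat.card_eq_fintype_card, Fintype.card_option, Fintype.card_fin]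
    omega
  vertex_mem_edge_iff := by simp
  mem_range_of_mem_of_mem i j := by simp

open Classical in
/-- The skeleton of a hypergraph consisting of all vertices, where `none` is a given vertex. -/
noncomputable def rooted [Fintype Γ.vertexSet] (hΓ : Γ.IsUniform r) {w : β} (hw : w ∈ Γ.vertexSet) :
    Skeleton Γ r fun e : Γ.edgeSet =>
      (univ.filter fun o : Option {x : Γ.vertexSet // (x : β) ≠ w} =>
      (o.elim w fun x => x) ∈ (e : Set β)) where
  vertex o := o.elim w fun x => x
  edge e := e
  vertex_injective := by
    rintro (_ | x) (_ | y) h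
    · rfl
    · exact absurd h.symm y.2
    · exact absurd h x.2
    · exact congrArg some (Subtype.ext (Subtype.ext h))
  vertex_mem := by
    rintro (_ | x)
    · exact hw
    · exact x.1.2
  edge_injective := Subtype.val_injective
  range_edge := Subtype.range_val
  ncard_edge e := hΓ e e.2
  vertex_mem_edge_iff e o := by simp
  mem_range_of_mem_of_mem e _ x hx _ _ := by
    by_cases h : x = w
    · exact ⟨none, h.symm⟩
    · exact ⟨some ⟨⟨x, mem_vertexSet_of_mem_edgeSet e.2 hx⟩, h⟩, rfl⟩

end Skeleton

end Hypergraph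

/-! ### Matchings of a glued hypergraph. -/

namespace Hypergraph.Skeleton

open Finset

section Matchings

variable {ι κ S S' : Type*}

/-- The edges with index in `A` are pairwise disjoint. -/
def IsMatching (T : ι → Finset S) (A : Finset ι) : Prop :=
  ∀ i ∈ A, ∀ j ∈ A, i ≠ j → Disjoint (T i) (T j)

/-- Edges from different parts can meet only at the glued vertex, so the parts interact only when
`C` covers it. -/
lemma isMatching_glueTrace [DecidableEq S] [DecidableEq S'] (T : ι → Finset S) (p : S)
    (T' : κ → Finset (Option S')) (B : Finset ι) (C : Finset κ) :
    IsMatching (glueTrace T p T') (B.disjSum C) ↔ IsMatching T B ∧ IsMatching T' C ∧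
      ((∃ k ∈ C, none ∈ T' k) → ∀ i ∈ B, Disjoint (T i) {p}) := by
  have hinl : ∀ i j, Disjoint (glueTrace T p T' (.inl i)) (glueTrace T p T' (.inl j)) ↔
      Disjoint (T i) (T j) := fun i j => by simp [disjoint_left]
  have hinr : ∀ k l, Disjoint (glueTrace T p T' (.inr k)) (glueTrace T p T' (.inr l)) ↔
      Disjoint (T' k) (T' l) := fun k l => by simp [disjoint_left, Option.forall]
  have hmix : ∀ i k, Disjoint (glueTrace T p T' (.inl i)) (glueTrace T p T' (.inr k)) ↔
      (none ∈ T' k → Disjoint (T i) {p}) := fun i k => by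
    simp [disjoint_left]
    grind
  simp only [IsMatching, Sum.forall, inl_mem_disjSum, inr_mem_disjSum, hinl, hinr, hmix,
    disjoint_comm (a := glueTrace T p T' (.inr _)) (b := glueTrace T p T' (.inl _)), ne_eq,
    Sum.inl.injEq, Sum.inr.injEq, reduceCtorEq, not_false_eq_true, true_imp_iff]
  constructor
  · rintro ⟨h1, h2⟩
    exact ⟨fun i hi => (h1 i hi).1, fun k hk => (h2 k hk).2,
      fun ⟨k, hk, hk'⟩ i hi => (h1 i hi).2 k hk hk'⟩
  · rintro ⟨h1, h2, h3⟩
    exact ⟨fun i hi => ⟨h1 i hi, fun k hk hk' => h3 ⟨k, hk, hk'⟩ i hi⟩,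
      fun k hk => ⟨fun i hi hk' => h3 ⟨k, hk, hk'⟩ i hi, h2 k hk⟩⟩

open Classical in
/-- The number of matchings with `k` edges from `s`, none of which meets `F`. -/
noncomputable def matchingCount (T : ι → Finset S) (s : Finset ι) (F : Finset S) (k : ℕ) : ℕ :=
  #{A ∈ s.powerset | IsMatching T A ∧ (∀ i ∈ A, Disjoint (T i) F) ∧ A.card = k}

lemma matchingCount_eq_zero (T : ι → Finset S) {s : Finset ι} (F : Finset S) {k : ℕ}
    (hk : s.card < k) : matchingCount T s F k = 0 := by
  classical
  rw [matchingCount, card_eq_zero, filter_eq_empty_iff]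
  rintro A hA ⟨-, -, rfl⟩
  exact absurd (card_le_card (mem_powerset.1 hA)) (not_le.2 hk)

variable [DecidableEq ι]

lemma isMatching_insert {T : ι → Finset S} {i : ι} {A : Finset ι} (hi : i ∉ A) :
    IsMatching T (insert i A) ↔ IsMatching T A ∧ ∀ j ∈ A, Disjoint (T j) (T i) := by
  simp only [IsMatching, mem_insert]
  constructor
  · exact fun h => ⟨fun j hj l hl => h j (.inr hj) l (.inr hl),
      fun j hj => h j (.inr hj) i (.inl rfl) (by rintro rfl; exact hi hj)⟩
  · rintro ⟨h1, h2⟩ j (rfl | hj) l (rfl | hl) hne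
    · exact absurd rfl hne
    · exact (h2 l hl).symm
    · exact h2 j hj
    · exact h1 j hj l hl hne

variable [DecidableEq S]

/-- Split by whether `i` is used; if it is, its vertices become forbidden for the other edges. -/
lemma matchingCount_insert (T : ι → Finset S) {s : Finset ι} {i : ι} (hi : i ∉ s) (F : Finset S)
    (k : ℕ) :
    matchingCount T (insert i s) F k = matchingCount T s F k +
      if Disjoint (T i) F ∧ k ≠ 0 then matchingCount T s (F ∪ T i) (k - 1) else 0 := by
  classical
  simp only [matchingCount, card_filter]
  rw [sum_powerset_insert hi]
  congr 1
  split_ifs with h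
  · refine sum_congr rfl fun A hA => ?_
    have hiA : i ∉ A := fun h => hi (mem_powerset.1 hA h)
    rw [isMatching_insert hiA, card_insert_of_notMem hiA]
    simp only [mem_insert, forall_eq_or_imp, disjoint_union_right]
    have hk : #A + 1 = k ↔ #A = k - 1 := by omega
    refine if_congr ?_ rfl rfl
    rw [hk]
    grind
  · refine sum_eq_zero fun A hA => if_neg fun hP => h ⟨hP.2.1 i (mem_insert_self i A), ?_⟩
    rw [← hP.2.2, card_insert_of_notMem fun h => hi (mem_powerset.1 hA h)]
    exact Nat.succ_ne_zero _

/-- A recursive computation of `matchingCount`. -/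
def countMatchings (T : ι → Finset S) : List ι → Finset S → ℕ → ℕ
  | [], _, k => if k = 0 then 1 else 0
  | i :: l, F, k => countMatchings T l F k +
      if Disjoint (T i) F ∧ k ≠ 0 then countMatchings T l (F ∪ T i) (k - 1) else 0

lemma matchingCount_toFinset (T : ι → Finset S) {l : List ι} (hl : l.Nodup) (F : Finset S)
    (k : ℕ) : matchingCount T l.toFinset F k = countMatchings T l F k := by
  induction l generalizing F k with
  | nil =>
    simp [matchingCount, countMatchings, IsMatching, filter_singleton, apply_ite card, eq_comm]
  | cons i l ih =>
    rw [List.nodup_cons] at hl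
    rw [List.toFinset_cons, matchingCount_insert T (by simpa using hl.1), countMatchings]
    simp only [ih hl.2]

variable [DecidableEq S']

-- Sorting by the part `C` inside `Γ` shows that the first factor enters only through its matching
-- numbers with and without the root forbidden.
open Classical in
lemma ncard_isMatching_glueTrace [Fintype ι] [Fintype κ] (T : ι → Finset S) (p : S)
    (T' : κ → Finset (Option S')) (k : ℕ) :
    {A : Finset (ι ⊕ κ) | A.card = k ∧ IsMatching (glueTrace T p T') A}.ncard =
      ∑ C : Finset κ, if IsMatching T' C ∧ #C ≤ k then
        matchingCount T univ (if ∃ l ∈ C, none ∈ T' l then {p} else ∅) (k - #C) else 0 := by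
  have h1 : {A : Finset (ι ⊕ κ) | A.card = k ∧ IsMatching (glueTrace T p T') A} =
      ({A | A.card = k ∧ IsMatching (glueTrace T p T') A} : Finset (Finset (ι ⊕ κ))) := by
    ext
    simp
  rw [h1, Set.ncard_coe_finset, card_filter,
    ← (sumEquiv (α := ι) (β := κ)).symm.toEquiv.sum_comp, Fintype.sum_prod_type, sum_comm]
  refine sum_congr rfl fun C _ => ?_
  have h2 : ∀ B : Finset ι, (sumEquiv (α := ι) (β := κ)).symm.toEquiv (B, C) = B.disjSum C :=
    fun _ => rfl
  simp only [h2, isMatching_glueTrace, card_disjSum, matchingCount, powerset_univ, card_filter]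
  by_cases hC : IsMatching T' C ∧ #C ≤ k
  · rw [if_pos hC]
    refine sum_congr rfl fun B _ => ?_
    have h3 : #B + #C = k ↔ #B = k - #C := by omega
    congr 1
    refine propext ?_
    rw [h3]
    by_cases h : ∃ l ∈ C, none ∈ T' l
    · simp only [h, hC.1, if_true]
      tauto
    · simp only [h, hC.1, if_false, disjoint_empty_right]
      tauto
  · rw [if_neg hC]
    exact sum_eq_zero fun B _ => if_neg fun h => hC ⟨h.2.2.1, by omega⟩

end Matchings

section Reindex

variable {α ι κ S S' : Type*} {H : Hypergraph α} {r : ℕ} {T : ι → Finset S} {T' : κ → Finset S'}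

/-- Renaming the vertices and the edges of a skeleton. -/
def reindex (K : Skeleton H r T) {f : κ → ι} (hf : Function.Bijective f) {g : S' → S}
    (hg : Function.Bijective g) (h : ∀ k q, g q ∈ T (f k) ↔ q ∈ T' k) : Skeleton H r T' where
  vertex := K.vertex ∘ g
  edge := K.edge ∘ f
  vertex_injective := K.vertex_injective.comp hg.1
  vertex_mem _ := K.vertex_mem _
  edge_injective := K.edge_injective.comp hf.1
  range_edge := by rw [hf.2.range_comp, K.range_edge]
  ncard_edge _ := K.ncard_edge _
  vertex_mem_edge_iff k q := (K.vertex_mem_edge_iff _ _).trans (h k q)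
  mem_range_of_mem_of_mem k l x hk hl hne := by
    rw [hg.2.range_comp]
    exact K.mem_range_of_mem_of_mem _ _ x hk hl (hf.1.ne hne)

end Reindex

/-! ### Splitting the reduced system at the glued vertex. -/

section Rooted

open SetFamily

variable {ι κ S S' : Type*}

/-- The conditions for a reduced solution, except that `X p` is replaced by `b` in the inequality
at `p`. -/
structure IsRootedSolution [Fintype ι] [DecidableEq S] (T : ι → Finset S) (p : S) (a b : ℝ)
    (X : S → ℝ) (W : ι → ℝ) : Prop where
  vertex_pos : ∀ q, 0 < X q
  edge_pos : ∀ i, 0 < W i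
  prod_le : ∀ i, a * ∏ q ∈ T i, X q ≤ W i ^ (T i).card
  sum_le : ∀ q, q ≠ p → ∑ i with q ∈ T i, W i ≤ X q
  sum_root_le : ∑ i with p ∈ T i, W i ≤ b

variable {T : ι → Finset S} {p : S} {T' : κ → Finset (Option S')}

lemma elim_injective : Function.Injective fun o : Option S' => o.elim (Sum.inl p) Sum.inr := by
  rintro (_ | x) (_ | y) h <;> simp_all

variable [DecidableEq S] [DecidableEq S']

lemma prod_glueTrace_inl (X : S ⊕ S' → ℝ) (i : ι) :
    ∏ q ∈ glueTrace T p T' (.inl i), X q = ∏ q ∈ T i, X (.inl q) :=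
  prod_image Sum.inl_injective.injOn

lemma prod_glueTrace_inr (X : S ⊕ S' → ℝ) (k : κ) :
    ∏ q ∈ glueTrace T p T' (.inr k), X q = ∏ o ∈ T' k, X (o.elim (.inl p) .inr) :=
  prod_image elim_injective.injOn

lemma card_glueTrace_inl (i : ι) : (glueTrace T p T' (.inl i)).card = (T i).card :=
  card_image_of_injective _ Sum.inl_injective

lemma card_glueTrace_inr (k : κ) : (glueTrace T p T' (.inr k)).card = (T' k).card :=
  card_image_of_injective _ elim_injective

variable [Fintype ι] [Fintype κ]

lemma sum_glueTrace (W : ι ⊕ κ → ℝ) (q : S ⊕ S') :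
    ∑ i with q ∈ glueTrace T p T' i, W i = (∑ i with q ∈ glueTrace T p T' (.inl i), W (.inl i)) +
      ∑ k with q ∈ glueTrace T p T' (.inr k), W (.inr k) := by
  simp only [sum_filter, Fintype.sum_sum_type]

/-- A reduced solution for a glued hypergraph amounts to compatible rooted solutions for the two
parts. -/
lemma exists_isReducedSolution_glueTrace_iff {a : ℝ} :
    (∃ X W, IsReducedSolution (glueTrace T p T') a X W) ↔
      ∃ z b : ℝ, (∃ X W, IsRootedSolution T p a b X W ∧ X p = z) ∧
        ∃ X W, IsRootedSolution T' none a (z - b) X W ∧ X none = z := by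
  constructor
  · rintro ⟨X, W, h⟩
    -- `b` is the exact amount which the edges of the first part use at the glued vertex.
    refine ⟨X (.inl p), ∑ i with p ∈ T i, W (.inl i),
      ⟨X ∘ .inl, W ∘ .inl, ⟨fun q => h.vertex_pos _, fun i => h.edge_pos _, fun i => ?_,
        fun q hq => ?_, le_rfl⟩, rfl⟩,
      ⟨fun o => X (o.elim (.inl p) .inr), W ∘ .inr, ⟨fun q => h.vertex_pos _,
        fun i => h.edge_pos _, fun k => ?_, fun o ho => ?_, ?_⟩, rfl⟩⟩
    · simpa only [prod_glueTrace_inl, card_glueTrace_inl, Function.comp_apply] using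
        h.prod_le (.inl i)
    · simpa [sum_glueTrace, hq] using h.sum_le (.inl q)
    · simpa only [prod_glueTrace_inr, card_glueTrace_inr, Function.comp_apply] using
        h.prod_le (.inr k)
    · cases o with
      | none => exact absurd rfl ho
      | some o => simpa [sum_glueTrace] using h.sum_le (.inr o)
    · have := h.sum_le (.inl p)
      simp only [sum_glueTrace, inl_mem_glueTrace_inl, inl_mem_glueTrace_inr, true_and] at this
      rw [le_sub_iff_add_le, add_comm]
      exact this
  · rintro ⟨z, b, ⟨X, W, h, hz⟩, X', W', h', hz'⟩
    have helim : ∀ o : Option S', Sum.elim X (X' ∘ some) (o.elim (.inl p) .inr) = X' o := by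
      rintro (_ | o)
      · exact hz.trans hz'.symm
      · rfl
    refine ⟨Sum.elim X (X' ∘ some), Sum.elim W W', ?_, ?_, ?_, ?_⟩
    · rintro (q | o)
      exacts [h.vertex_pos q, h'.vertex_pos _]
    · rintro (i | k)
      exacts [h.edge_pos i, h'.edge_pos k]
    · rintro (i | k)
      · simpa only [prod_glueTrace_inl, card_glueTrace_inl, Sum.elim_inl] using h.prod_le i
      · simpa only [prod_glueTrace_inr, card_glueTrace_inr, helim, Sum.elim_inr] using h'.prod_le k
    · rintro (q | o)
      · rw [sum_glueTrace]
        by_cases hq : q = p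
        · subst hq
          have h1 := h.sum_root_le
          have h2 := h'.sum_root_le
          simp only [inl_mem_glueTrace_inl, inl_mem_glueTrace_inr, true_and, Sum.elim_inl,
            Sum.elim_inr]
          linarith
        · simpa [hq] using h.sum_le q hq
      · simpa [sum_glueTrace] using h'.sum_le (some o) (by simp)

end Rooted

end Hypergraph.Skeleton

/-! ### The two trees: matching numbers and the condition at the root. -/

namespace Hypergraph.Skeleton

open Finset

/-- The traces of the edges of `R(1, 1, 2, 4)` on the path vertices `0, …, 8` and on a vertex `9` of
the second pendent edge. The edges are listed along the path, followed by the pendent edges. -/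
def traceSecond : Fin 11 → Finset (Fin 10) :=
  ![{0, 1}, {1, 2}, {2, 3}, {3, 4}, {4, 5}, {5, 6}, {6, 7}, {7, 8}, {1}, {2, 9}, {4}]

/-- The traces of the edges of `R(1, 3, 1, 3)` on the path vertices `0, …, 8` and on a vertex `9` of
the third pendent edge. The edges are listed along the path, followed by the pendent edges. -/
def traceThird : Fin 11 → Finset (Fin 10) :=
  ![{0, 1}, {1, 2}, {2, 3}, {3, 4}, {4, 5}, {5, 6}, {6, 7}, {7, 8}, {1}, {4}, {5, 9}]

lemma matchingCount_univ_eq {n : ℕ} {S : Type*} [DecidableEq S] (T : Fin n → Finset S)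
    (F : Finset S) (k : ℕ) :
    matchingCount T univ F k = countMatchings T (List.finRange n) F k := by
  rw [← matchingCount_toFinset T (List.nodup_finRange n)]
  congr
  ext
  simp

/-- With `11` edges there is no matching of size `12` or more; the remaining sizes are evaluated by
the recursion. -/
lemma matchingCount_traceSecond_empty (k : ℕ) :
    matchingCount traceSecond univ ∅ k = matchingCount traceThird univ ∅ k := by
  by_cases hk : k < 12
  · rw [matchingCount_univ_eq, matchingCount_univ_eq]
    revert k
    decide +kernel
  · rw [matchingCount_eq_zero, matchingCount_eq_zero] <;> rw [card_univ, Fintype.card_fin] <;> omega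

lemma matchingCount_traceSecond_singleton (k : ℕ) :
    matchingCount traceSecond univ {9} k = matchingCount traceThird univ {9} k := by
  by_cases hk : k < 12
  · rw [matchingCount_univ_eq, matchingCount_univ_eq]
    revert k
    decide +kernel
  · rw [matchingCount_eq_zero, matchingCount_eq_zero] <;> rw [card_univ, Fintype.card_fin] <;> omega

lemma isRootedSolution_traceSecond_iff {a b : ℝ} {X : Fin 10 → ℝ} {W : Fin 11 → ℝ} :
    IsRootedSolution traceSecond 9 a b X W ↔ (∀ q, 0 < X q) ∧ (∀ i, 0 < W i) ∧
      (a * (X 0 * X 1) ≤ W 0 ^ 2 ∧ a * (X 1 * X 2) ≤ W 1 ^ 2 ∧ a * (X 2 * X 3) ≤ W 2 ^ 2 ∧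
        a * (X 3 * X 4) ≤ W 3 ^ 2 ∧ a * (X 4 * X 5) ≤ W 4 ^ 2 ∧ a * (X 5 * X 6) ≤ W 5 ^ 2 ∧
        a * (X 6 * X 7) ≤ W 6 ^ 2 ∧ a * (X 7 * X 8) ≤ W 7 ^ 2 ∧ a * X 1 ≤ W 8 ∧
        a * (X 2 * X 9) ≤ W 9 ^ 2 ∧ a * X 4 ≤ W 10) ∧
      (W 0 ≤ X 0 ∧ W 0 + (W 1 + W 8) ≤ X 1 ∧ W 1 + (W 2 + W 9) ≤ X 2 ∧ W 2 + W 3 ≤ X 3 ∧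
        W 3 + (W 4 + W 10) ≤ X 4 ∧ W 4 + W 5 ≤ X 5 ∧
        W 5 + W 6 ≤ X 6 ∧ W 6 + W 7 ≤ X 7 ∧ W 7 ≤ X 8) ∧ W 9 ≤ b := by
  have h : IsRootedSolution traceSecond 9 a b X W ↔ (∀ q, 0 < X q) ∧ (∀ i, 0 < W i) ∧
      (∀ i, a * ∏ q ∈ traceSecond i, X q ≤ W i ^ (traceSecond i).card) ∧
      (∀ q, q ≠ 9 → ∑ i with q ∈ traceSecond i, W i ≤ X q) ∧
      ∑ i with 9 ∈ traceSecond i, W i ≤ b :=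
    ⟨fun ⟨h1, h2, h3, h4, h5⟩ => ⟨h1, h2, h3, h4, h5⟩,
      fun ⟨h1, h2, h3, h4, h5⟩ => ⟨h1, h2, h3, h4, h5⟩⟩
  rw [h]
  refine and_congr_right' (and_congr_right' (and_congr ?_ (and_congr ?_ ?_)))
  · simp [Fin.forall_fin_succ, traceSecond]
  · simp only [sum_filter, Fin.sum_univ_succ]
    simp [Fin.forall_fin_succ, traceSecond]
  · simp only [sum_filter, Fin.sum_univ_succ]
    simp [traceSecond]

lemma isRootedSolution_traceThird_iff {a b : ℝ} {X : Fin 10 → ℝ} {W : Fin 11 → ℝ} :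
    IsRootedSolution traceThird 9 a b X W ↔ (∀ q, 0 < X q) ∧ (∀ i, 0 < W i) ∧
      (a * (X 0 * X 1) ≤ W 0 ^ 2 ∧ a * (X 1 * X 2) ≤ W 1 ^ 2 ∧ a * (X 2 * X 3) ≤ W 2 ^ 2 ∧
        a * (X 3 * X 4) ≤ W 3 ^ 2 ∧ a * (X 4 * X 5) ≤ W 4 ^ 2 ∧ a * (X 5 * X 6) ≤ W 5 ^ 2 ∧
        a * (X 6 * X 7) ≤ W 6 ^ 2 ∧ a * (X 7 * X 8) ≤ W 7 ^ 2 ∧ a * X 1 ≤ W 8 ∧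
        a * X 4 ≤ W 9 ∧ a * (X 5 * X 9) ≤ W 10 ^ 2) ∧
      (W 0 ≤ X 0 ∧ W 0 + (W 1 + W 8) ≤ X 1 ∧ W 1 + W 2 ≤ X 2 ∧ W 2 + W 3 ≤ X 3 ∧
        W 3 + (W 4 + W 9) ≤ X 4 ∧ W 4 + (W 5 + W 10) ≤ X 5 ∧
        W 5 + W 6 ≤ X 6 ∧ W 6 + W 7 ≤ X 7 ∧ W 7 ≤ X 8) ∧ W 10 ≤ b := by
  have h : IsRootedSolution traceThird 9 a b X W ↔ (∀ q, 0 < X q) ∧ (∀ i, 0 < W i) ∧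
      (∀ i, a * ∏ q ∈ traceThird i, X q ≤ W i ^ (traceThird i).card) ∧
      (∀ q, q ≠ 9 → ∑ i with q ∈ traceThird i, W i ≤ X q) ∧
      ∑ i with 9 ∈ traceThird i, W i ≤ b :=
    ⟨fun ⟨h1, h2, h3, h4, h5⟩ => ⟨h1, h2, h3, h4, h5⟩,
      fun ⟨h1, h2, h3, h4, h5⟩ => ⟨h1, h2, h3, h4, h5⟩⟩
  rw [h]
  refine and_congr_right' (and_congr_right' (and_congr ?_ (and_congr ?_ ?_)))
  · simp [Fin.forall_fin_succ, traceThird]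
  · simp only [sum_filter, Fin.sum_univ_succ]
    simp [Fin.forall_fin_succ, traceThird]
  · simp only [sum_filter, Fin.sum_univ_succ]
    simp [traceThird]

/-- One step of the elimination of a branch: `x` and `y` are the values at the ends of an edge, and
`N / D` is the part of `x` which is left for this edge. -/
lemma pos_and_le_of_mul_le (a y : ℝ) {x w N D : ℝ} (hx : 0 < x) (hw : 0 < w)
    (hD : 0 < D) (he : a * (x * y) ≤ w ^ 2) (h : D * w ≤ N * x) :
    0 < N ∧ a * D * y ≤ N * w := by
  have hN : 0 < N := pos_of_mul_pos_left ((mul_pos hD hw).trans_le h) hx.le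
  refine ⟨hN, le_of_mul_le_mul_right ?_ hx⟩
  nlinarith [mul_le_mul_of_nonneg_left he hD.le, mul_le_mul_of_nonneg_right h hw.le]

/-- The condition for the solvability of the rooted systems of `R(1, 1, 2, 4)` and
`R(1, 3, 1, 3)`. -/
def RootCondition (a b z : ℝ) : Prop :=
  0 < 1 - 2 * a ∧ 0 < 1 - 4 * a + a ^ 2 ∧
    0 < (1 - 3 * a) * (1 - 4 * a + a ^ 2) - a * (1 - 5 * a + 6 * a ^ 2 - a ^ 3) ∧
    a * ((1 - 2 * a) * (1 - 4 * a + a ^ 2)) * z ≤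
      ((1 - 3 * a) * (1 - 4 * a + a ^ 2) - a * (1 - 5 * a + 6 * a ^ 2 - a ^ 3)) * b

/-- The two positivity conditions select the side `a < 2 - √3 ≈ 0.268` of the roots of `1 - 4a +
a²`. A bound below `1 / 3` is what makes `1 - 3a` positive. -/
lemma RootCondition.lt {a b z : ℝ} (h : RootCondition a b z) : a < 3 / 10 := by
  obtain ⟨h1, h2, -⟩ := h
  nlinarith

lemma rootCondition_of_traceSecond {a b z : ℝ} {X : Fin 10 → ℝ} {W : Fin 11 → ℝ}
    (h : IsRootedSolution traceSecond 9 a b X W) (hz : X 9 = z) : RootCondition a b z := by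
  obtain ⟨hX, hW, ⟨e0, e1, e2, e3, e4, e5, e6, e7, e8, e9, e10⟩,
    ⟨v0, v1, v2, v3, v4, v5, v6, v7, v8⟩, hb⟩ := isRootedSolution_traceSecond_iff.1 h
  -- Both ends of the path are eliminated towards vertex `2`. At each vertex the remaining fraction
  -- is `1`, minus `a` for a pendent edge reduced to that vertex, minus `a * D / N` for each branch
  -- already eliminated.
  obtain ⟨-, w0⟩ := pos_and_le_of_mul_le a (X 1) (N := 1) (hX 0) (hW 0) one_pos e0 (by linarith)
  obtain ⟨n1, w1⟩ := pos_and_le_of_mul_le a (X 2) (N := 1 - 2 * a) (hX 1) (hW 1) one_pos e1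
    (by linarith)
  obtain ⟨-, w7⟩ := pos_and_le_of_mul_le a (X 7) (N := 1) (hX 8) (hW 7) one_pos
    (by linarith) (by linarith)
  obtain ⟨n6, w6⟩ := pos_and_le_of_mul_le a (X 6) (N := 1 - a) (hX 7) (hW 6) one_pos
    (by linarith) (by linarith)
  obtain ⟨n5, w5⟩ := pos_and_le_of_mul_le a (X 5) (N := 1 - 2 * a) (hX 6) (hW 5) n6
    (by linarith) (by linarith [mul_le_mul_of_nonneg_left v6 n6.le])
  obtain ⟨n4, w4⟩ := pos_and_le_of_mul_le a (X 4) (N := 1 - 3 * a + a ^ 2) (hX 5) (hW 4) n5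
    (by linarith) (by linarith [mul_le_mul_of_nonneg_left v5 n5.le])
  obtain ⟨n3, w3⟩ := pos_and_le_of_mul_le a (X 3) (N := 1 - 5 * a + 6 * a ^ 2 - a ^ 3) (hX 4)
    (hW 3) n4 (by linarith)
    (by linarith [mul_le_mul_of_nonneg_left v4 n4.le, mul_le_mul_of_nonneg_left e10 n4.le])
  obtain ⟨n2, w2⟩ := pos_and_le_of_mul_le a (X 2) (N := (1 - 2 * a) * (1 - 4 * a + a ^ 2)) (hX 3)
    (hW 2) n3 (by linarith) (by linarith [mul_le_mul_of_nonneg_left v3 n3.le])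
  have n2' := pos_of_mul_pos_right n2 n1.le
  have w2' : a * (1 - 5 * a + 6 * a ^ 2 - a ^ 3) * X 2 ≤
      (1 - 2 * a) * (1 - 4 * a + a ^ 2) * W 2 := w2
  -- The branches at vertex `2` are put over the common denominator `(1 - 2a)(1 - 4a + a²)`, and the
  -- edge to the root is the last step.
  obtain ⟨n9, w9⟩ := pos_and_le_of_mul_le a (X 9)
    (N := (1 - 3 * a) * (1 - 4 * a + a ^ 2) - a * (1 - 5 * a + 6 * a ^ 2 - a ^ 3)) (hX 2)
    (hW 9) n2 e9
    (by linarith [mul_le_mul_of_nonneg_left v2 n2.le, mul_le_mul_of_nonneg_left w1 n2'.le])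
  refine ⟨n1, n2', n9, ?_⟩
  rw [← hz]
  exact w9.trans (mul_le_mul_of_nonneg_left hb n9.le)

lemma rootCondition_of_traceThird {a b z : ℝ} {X : Fin 10 → ℝ} {W : Fin 11 → ℝ}
    (h : IsRootedSolution traceThird 9 a b X W) (hz : X 9 = z) : RootCondition a b z := by
  obtain ⟨hX, hW, ⟨e0, e1, e2, e3, e4, e5, e6, e7, e8, e9, e10⟩,
    ⟨v0, v1, v2, v3, v4, v5, v6, v7, v8⟩, hb⟩ := isRootedSolution_traceThird_iff.1 h
  obtain ⟨-, w0⟩ := pos_and_le_of_mul_le a (X 1) (N := 1) (hX 0) (hW 0) one_pos e0 (by linarith)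
  obtain ⟨n1, w1⟩ := pos_and_le_of_mul_le a (X 2) (N := 1 - 2 * a) (hX 1) (hW 1) one_pos e1
    (by linarith)
  obtain ⟨n2, w2⟩ := pos_and_le_of_mul_le a (X 3) (N := 1 - 3 * a) (hX 2) (hW 2) n1 e2
    (by linarith [mul_le_mul_of_nonneg_left v2 n1.le])
  obtain ⟨n3, w3⟩ := pos_and_le_of_mul_le a (X 4) (N := 1 - 4 * a + 2 * a ^ 2) (hX 3) (hW 3) n2 e3
    (by linarith [mul_le_mul_of_nonneg_left v3 n2.le])
  obtain ⟨n4, w4⟩ := pos_and_le_of_mul_le a (X 5) (N := (1 - 2 * a) * (1 - 4 * a + a ^ 2)) (hX 4)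
    (hW 4) n3 e4
    (by linarith [mul_le_mul_of_nonneg_left v4 n3.le, mul_le_mul_of_nonneg_left e9 n3.le])
  obtain ⟨-, w7⟩ := pos_and_le_of_mul_le a (X 7) (N := 1) (hX 8) (hW 7) one_pos
    (by linarith) (by linarith)
  obtain ⟨n6, w6⟩ := pos_and_le_of_mul_le a (X 6) (N := 1 - a) (hX 7) (hW 6) one_pos
    (by linarith) (by linarith)
  obtain ⟨n5, w5⟩ := pos_and_le_of_mul_le a (X 5) (N := 1 - 2 * a) (hX 6) (hW 5) n6
    (by linarith) (by linarith [mul_le_mul_of_nonneg_left v6 n6.le])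
  have n4' := pos_of_mul_pos_right n4 n1.le
  -- The branches meet at vertex `5` here. Over the same common denominator the numerator is `(1 -
  -- 2a)(1 - 4a + a²) - a(1 - 4a + 2a²) - a(1 - a)(1 - 4a + a²)`, which expands to the same
  -- polynomial as for the other tree.
  obtain ⟨n10, w10⟩ := pos_and_le_of_mul_le a (X 9)
    (N := (1 - 3 * a) * (1 - 4 * a + a ^ 2) - a * (1 - 5 * a + 6 * a ^ 2 - a ^ 3)) (hX 5)
    (hW 10) n4 e10
    (by linarith [mul_le_mul_of_nonneg_left v5 n4.le, mul_le_mul_of_nonneg_left w5 n4'.le])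
  refine ⟨n1, n4', n10, ?_⟩
  rw [← hz]
  exact w10.trans (mul_le_mul_of_nonneg_left hb n10.le)

/-- The converse step: given the value `y` at one end of an edge, there are values at the other end
and at the edge for which all the inequalities are sharp. -/
lemma exists_mul_eq {a y N D : ℝ} (ha : 0 < a) (hy : 0 < y) (hD : 0 < D) (hN : 0 < N) :
    ∃ x w, 0 < x ∧ 0 < w ∧ a * (x * y) = w ^ 2 ∧ D * w = N * x ∧ N * w = a * D * y := by
  refine ⟨a * (D / N) ^ 2 * y, a * (D / N) * y, by positivity, by positivity, ?_, ?_, ?_⟩ <;>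
  field_simp

lemma RootCondition.exists_traceSecond {a b z : ℝ} (ha : 0 < a) (hz : 0 < z)
    (h : RootCondition a b z) :
    ∃ X W, IsRootedSolution traceSecond 9 a b X W ∧ X 9 = z := by
  have hlt := h.lt
  obtain ⟨n1, n2', n9, hb⟩ := h
  have n6 : 0 < 1 - a := by linarith
  have n4 : 0 < 1 - 3 * a + a ^ 2 := by nlinarith
  -- This is `(1 - a)(1 - 4a + a²) + a²`.
  have n3 : 0 < 1 - 5 * a + 6 * a ^ 2 - a ^ 3 := by nlinarith [mul_pos n6 n2']
  have n2 := mul_pos n1 n2'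
  -- The elimination is run backwards: starting from `z`, the values are chosen outwards with
  -- equality in every step, so only the inequality at the root uses the bound on `b`.
  obtain ⟨x2, w9, px2, pw9, e9, f9, g9⟩ := exists_mul_eq ha hz n2 n9
  obtain ⟨x1, w1, px1, pw1, e1, f1, g1⟩ := exists_mul_eq ha px2 one_pos n1
  obtain ⟨x3, w2, px3, pw2, e2, f2, g2⟩ := exists_mul_eq ha px2 n3 n2
  obtain ⟨x4, w3, px4, pw3, e3, f3, g3⟩ := exists_mul_eq ha px3 n4 n3
  obtain ⟨x5, w4, px5, pw4, e4, f4, g4⟩ := exists_mul_eq ha px4 n1 n4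
  obtain ⟨x6, w5, px6, pw5, e5, f5, g5⟩ := exists_mul_eq ha px5 n6 n1
  obtain ⟨x7, w6, px7, pw6, e6, f6, g6⟩ := exists_mul_eq ha px6 one_pos n6
  have px0 := mul_pos ha px1
  have px8 := mul_pos ha px7
  have px10 := mul_pos ha px4
  refine ⟨![a * x1, x1, x2, x3, x4, x5, x6, x7, a * x7, z],
    ![a * x1, w1, w2, w3, w4, w5, w6, a * x7, a * x1, w9, a * x4],
    isRootedSolution_traceSecond_iff.2 ⟨?_, ?_, ⟨?_, ?_, ?_, ?_, ?_, ?_, ?_, ?_, ?_, ?_, ?_⟩,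
      ⟨?_, ?_, ?_, ?_, ?_, ?_, ?_, ?_, ?_⟩, ?_⟩, rfl⟩
  · simp [Fin.forall_fin_succ, *]
  · simp [Fin.forall_fin_succ, *]
  all_goals simp only [Matrix.cons_val]
  · exact le_of_eq (by ring)
  · linarith
  · linarith
  · linarith
  · linarith
  · linarith
  · linarith
  · exact le_of_eq (by ring)
  · exact le_rfl
  · exact e9.le
  · exact le_rfl
  · exact le_rfl
  · linarith
  · exact (mul_left_cancel₀ n2.ne'
      (by linear_combination (1 - 4 * a + a ^ 2) * g1 + g2 + f9)).le
  · exact (mul_left_cancel₀ n3.ne' (by linear_combination g3 + f2)).le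
  · exact (mul_left_cancel₀ n4.ne' (by linear_combination g4 + f3)).le
  · exact (mul_left_cancel₀ n1.ne' (by linear_combination g5 + f4)).le
  · exact (mul_left_cancel₀ n6.ne' (by linear_combination g6 + f5)).le
  · linarith
  · exact le_rfl
  · exact le_of_mul_le_mul_left (g9.trans_le hb) n9

lemma RootCondition.exists_traceThird {a b z : ℝ} (ha : 0 < a) (hz : 0 < z)
    (h : RootCondition a b z) :
    ∃ X W, IsRootedSolution traceThird 9 a b X W ∧ X 9 = z := by
  have hlt := h.lt
  obtain ⟨n1, n4', n10, hb⟩ := h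
  have n6 : 0 < 1 - a := by linarith
  have n2 : 0 < 1 - 3 * a := by linarith
  have n3 : 0 < 1 - 4 * a + 2 * a ^ 2 := by nlinarith
  have n4 := mul_pos n1 n4'
  obtain ⟨x5, w10, px5, pw10, e10, f10, g10⟩ := exists_mul_eq ha hz n4 n10
  obtain ⟨x4, w4, px4, pw4, e4, f4, g4⟩ := exists_mul_eq ha px5 n3 n4
  obtain ⟨x3, w3, px3, pw3, e3, f3, g3⟩ := exists_mul_eq ha px4 n2 n3
  obtain ⟨x2, w2, px2, pw2, e2, f2, g2⟩ := exists_mul_eq ha px3 n1 n2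
  obtain ⟨x1, w1, px1, pw1, e1, f1, g1⟩ := exists_mul_eq ha px2 one_pos n1
  obtain ⟨x6, w5, px6, pw5, e5, f5, g5⟩ := exists_mul_eq ha px5 n6 n1
  obtain ⟨x7, w6, px7, pw6, e6, f6, g6⟩ := exists_mul_eq ha px6 one_pos n6
  have px0 := mul_pos ha px1
  have px8 := mul_pos ha px7
  have px9 := mul_pos ha px4
  refine ⟨![a * x1, x1, x2, x3, x4, x5, x6, x7, a * x7, z],
    ![a * x1, w1, w2, w3, w4, w5, w6, a * x7, a * x1, a * x4, w10],
    isRootedSolution_traceThird_iff.2 ⟨?_, ?_, ⟨?_, ?_, ?_, ?_, ?_, ?_, ?_, ?_, ?_, ?_, ?_⟩,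
      ⟨?_, ?_, ?_, ?_, ?_, ?_, ?_, ?_, ?_⟩, ?_⟩, rfl⟩
  · simp [Fin.forall_fin_succ, *]
  · simp [Fin.forall_fin_succ, *]
  all_goals simp only [Matrix.cons_val]
  · exact le_of_eq (by ring)
  · linarith
  · linarith
  · linarith
  · linarith
  · linarith
  · linarith
  · exact le_of_eq (by ring)
  · exact le_rfl
  · exact le_rfl
  · exact e10.le
  · exact le_rfl
  · linarith
  · exact (mul_left_cancel₀ n1.ne' (by linear_combination g1 + f2)).le
  · exact (mul_left_cancel₀ n2.ne' (by linear_combination g2 + f3)).le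
  · exact (mul_left_cancel₀ n3.ne' (by linear_combination g3 + f4)).le
  · exact (mul_left_cancel₀ n4.ne'
      (by linear_combination g4 + (1 - 4 * a + a ^ 2) * g5 + f10)).le
  · exact (mul_left_cancel₀ n6.ne' (by linear_combination g6 + f5)).le
  · linarith
  · exact le_rfl
  · exact le_of_mul_le_mul_left (g10.trans_le hb) n10

/-- Both sides amount to `RootCondition a b z` and `0 < z`. -/
lemma exists_isRootedSolution_traceSecond_iff {a b z : ℝ} (ha : 0 < a) :
    (∃ X W, IsRootedSolution traceSecond 9 a b X W ∧ X 9 = z) ↔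
      ∃ X W, IsRootedSolution traceThird 9 a b X W ∧ X 9 = z := by
  constructor
  · rintro ⟨X, W, h, hz⟩
    exact (rootCondition_of_traceSecond h hz).exists_traceThird ha (hz ▸ h.vertex_pos 9)
  · rintro ⟨X, W, h, hz⟩
    exact (rootCondition_of_traceThird h hz).exists_traceSecond ha (hz ▸ h.vertex_pos 9)

end Hypergraph.Skeleton

/-! ### Connectedness, vertex numbers and skeletons of `R(a, b, c, d)`. -/

namespace Hypergraph

section Supertree

variable {r : ℕ}

lemma isConnected_singleEdge : (singleEdge r).IsConnected :=
  isConnected_of_forall_reflTransGen (x := none) (Set.mem_univ _) fun _ _ =>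
    .single ⟨Set.univ, rfl, Set.mem_univ _, Set.mem_univ _⟩

lemma isConnected_loosePath {t : ℕ} : (loosePath r t).IsConnected := by
  have hpath : ∀ i : Fin (t + 1),
      Relation.ReflTransGen (loosePath r t).Adj (Sum.inl 0) (Sum.inl i) := fun i => by
    induction i using Fin.induction with
    | zero => exact .refl
    | succ i ih => exact ih.tail ⟨_, ⟨i, rfl⟩, by simp, by simp⟩
  refine isConnected_of_forall_reflTransGen (x := Sum.inl 0) (Set.mem_univ _) ?_
  rintro (i | ⟨i, j⟩) -
  · exact hpath i
  · exact (hpath i.castSucc).tail ⟨_, ⟨i, rfl⟩, by simp, by simp⟩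

lemma isConnected_supertreeR {a b c d : ℕ} : (supertreeR r a b c d).IsConnected := by
  refine IsConnected.glue (IsConnected.glue (IsConnected.glue isConnected_loosePath
    isConnected_singleEdge ?_ ?_) isConnected_singleEdge ?_ ?_) isConnected_singleEdge ?_ ?_
  all_goals first
    | exact Set.mem_univ _
    | exact Or.inl ⟨_, Set.mem_univ _, rfl⟩
    | exact Or.inl ⟨_, Or.inl ⟨_, Set.mem_univ _, rfl⟩, rfl⟩

lemma ncard_vertexSet_supertreeR {a b c d : ℕ} :
    (supertreeR r a b c d).vertexSet.ncard = (loosePath r (a + b + c + d)).vertexSet.ncard +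
      3 * ((singleEdge r).vertexSet \ {none}).ncard := by
  have h1 := ncard_vertexSet_glue (w := none) ((loosePath r (a + b + c + d)).vertexSet.toFinite)
    (singleEdge r).vertexSet.toFinite (Set.mem_univ (Sum.inl ⟨a, by omega⟩))
  have h2 := ncard_vertexSet_glue (w := none)
    ((loosePath r (a + b + c + d)).attachPendentEdge (Sum.inl ⟨a, by omega⟩) r).vertexSet.toFinite
    (singleEdge r).vertexSet.toFinite
    (Or.inl ⟨_, Set.mem_univ (Sum.inl ⟨a + b, by omega⟩), rfl⟩)
  have h3 := ncard_vertexSet_glue (w := none)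
    (((loosePath r (a + b + c + d)).attachPendentEdge (Sum.inl ⟨a, by omega⟩) r).attachPendentEdge
      (Sum.inl (Sum.inl ⟨a + b, by omega⟩)) r).vertexSet.toFinite
    (singleEdge r).vertexSet.toFinite
    (Or.inl ⟨_, Or.inl ⟨_, Set.mem_univ (Sum.inl ⟨a + b + c, by omega⟩), rfl⟩, rfl⟩)
  refine (h3.trans (congrArg (· + _) (h2.trans (congrArg (· + _) h1)))).trans ?_
  ring

end Supertree

namespace Skeleton

variable {r : ℕ}

/-- A skeleton of `R(a, b, c, d)` consisting of the path vertices and of given pendent vertices. -/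
noncomputable def supertreeR {S₁ S₂ S₃ : Type*} [Fintype S₁] [Fintype S₂] [Fintype S₃]
    [DecidableEq S₁] [DecidableEq S₂] [DecidableEq S₃] (hr : 2 ≤ r) (a b c d : ℕ)
    (g₁ : S₁ ↪ Fin (r - 1)) (g₂ : S₂ ↪ Fin (r - 1)) (g₃ : S₃ ↪ Fin (r - 1)) :
    Skeleton (supertreeR r a b c d) r
      (glueTrace (glueTrace (glueTrace (fun i : Fin (a + b + c + d) => {i.castSucc, i.succ})
        ⟨a, by clear hr; omega⟩ fun _ : Unit => (Finset.univ : Finset (Option S₁)))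
        (Sum.inl ⟨a + b, by clear hr; omega⟩) fun _ : Unit => (Finset.univ : Finset (Option S₂)))
        (Sum.inl (Sum.inl ⟨a + b + c, by clear hr; omega⟩))
        fun _ : Unit => (Finset.univ : Finset (Option S₃))) :=
  (((loosePath hr (a + b + c + d)).glue hr (singleEdge (by omega) g₁) ⟨a, by omega⟩).glue hr
    (singleEdge (by omega) g₂) (Sum.inl ⟨a + b, by omega⟩)).glue hr (singleEdge (by omega) g₃)
    (Sum.inl (Sum.inl ⟨a + b + c, by omega⟩))

/-- Only the pendent edge carrying the root needs a pendent vertex in the skeleton, hence `Unit` for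
the second edge and `Empty` for the others. The incidences then form a finite check independent of
`r`. -/
lemma exists_skeleton_traceSecond (hr : 2 ≤ r) (j : Fin (r - 1)) :
    ∃ K : Skeleton (Hypergraph.supertreeR r 1 1 2 4) r traceSecond,
      K.vertex 9 = pendentAtSecond r 1 1 2 4 j := by
  let f : Fin 11 → ((Fin 8 ⊕ Unit) ⊕ Unit) ⊕ Unit :=
    ![.inl (.inl (.inl 0)), .inl (.inl (.inl 1)), .inl (.inl (.inl 2)), .inl (.inl (.inl 3)),
      .inl (.inl (.inl 4)), .inl (.inl (.inl 5)), .inl (.inl (.inl 6)), .inl (.inl (.inl 7)),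
      .inl (.inl (.inr ())), .inl (.inr ()), .inr ()]
  let g : Fin 10 → ((Fin 9 ⊕ Empty) ⊕ Unit) ⊕ Empty :=
    ![.inl (.inl (.inl 0)), .inl (.inl (.inl 1)), .inl (.inl (.inl 2)), .inl (.inl (.inl 3)),
      .inl (.inl (.inl 4)), .inl (.inl (.inl 5)), .inl (.inl (.inl 6)), .inl (.inl (.inl 7)),
      .inl (.inl (.inl 8)), .inl (.inr ())]
  have hf : Function.Bijective f := by decide
  have hg : Function.Bijective g := by decide
  exact ⟨(supertreeR hr 1 1 2 4 Function.Embedding.ofIsEmpty ⟨fun _ : Unit => j, fun _ _ _ => rfl⟩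
    Function.Embedding.ofIsEmpty).reindex (f := f) (g := g) hf hg (by decide), rfl⟩

lemma exists_skeleton_traceThird (hr : 2 ≤ r) (j : Fin (r - 1)) :
    ∃ K : Skeleton (Hypergraph.supertreeR r 1 3 1 3) r traceThird,
      K.vertex 9 = pendentAtThird r 1 3 1 3 j := by
  let f : Fin 11 → ((Fin 8 ⊕ Unit) ⊕ Unit) ⊕ Unit :=
    ![.inl (.inl (.inl 0)), .inl (.inl (.inl 1)), .inl (.inl (.inl 2)), .inl (.inl (.inl 3)),
      .inl (.inl (.inl 4)), .inl (.inl (.inl 5)), .inl (.inl (.inl 6)), .inl (.inl (.inl 7)),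
      .inl (.inl (.inr ())), .inl (.inr ()), .inr ()]
  let g : Fin 10 → ((Fin 9 ⊕ Empty) ⊕ Empty) ⊕ Unit :=
    ![.inl (.inl (.inl 0)), .inl (.inl (.inl 1)), .inl (.inl (.inl 2)), .inl (.inl (.inl 3)),
      .inl (.inl (.inl 4)), .inl (.inl (.inl 5)), .inl (.inl (.inl 6)), .inl (.inl (.inl 7)),
      .inl (.inl (.inl 8)), .inr ()]
  have hf : Function.Bijective f := by decide
  have hg : Function.Bijective g := by decide
  exact ⟨(supertreeR hr 1 3 1 3 Function.Embedding.ofIsEmpty Function.Embedding.ofIsEmpty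
    ⟨fun _ : Unit => j, fun _ _ _ => rfl⟩).reindex (f := f) (g := g) hf hg (by decide), rfl⟩

variable {κ S' : Type*} [Fintype κ] [DecidableEq S']

open SetFamily in
lemma setOf_isReducedSolution_traceSecond (T' : κ → Finset (Option S')) :
    {t : ℝ | 0 < t ∧ ∃ X W, IsReducedSolution (glueTrace traceSecond 9 T') (t ^ r)⁻¹ X W} =
      {t : ℝ | 0 < t ∧ ∃ X W, IsReducedSolution (glueTrace traceThird 9 T') (t ^ r)⁻¹ X W} := by
  ext t
  refine and_congr_right fun ht => ?_
  have ha : 0 < (t ^ r)⁻¹ := inv_pos.2 (pow_pos ht r)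
  rw [exists_isReducedSolution_glueTrace_iff, exists_isReducedSolution_glueTrace_iff]
  simp only [exists_isRootedSolution_traceSecond_iff ha]

lemma ncard_isMatching_traceSecond (T' : κ → Finset (Option S')) (k : ℕ) :
    {A | A.card = k ∧ IsMatching (glueTrace traceSecond 9 T') A}.ncard =
      {A | A.card = k ∧ IsMatching (glueTrace traceThird 9 T') A}.ncard := by
  rw [ncard_isMatching_glueTrace, ncard_isMatching_glueTrace]
  refine Finset.sum_congr rfl fun C _ => ?_
  have hcount : ∀ l, ∀ F : Finset (Fin 10), F = {9} ∨ F = ∅ →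
      matchingCount traceSecond Finset.univ F l = matchingCount traceThird Finset.univ F l := by
    rintro l _ (rfl | rfl)
    exacts [matchingCount_traceSecond_singleton l, matchingCount_traceSecond_empty l]
  rw [hcount _ _ (ite_eq_or_eq _ _ _)]

end Skeleton

end Hypergraph

/-! ### The theorem. -/

open Hypergraph Skeleton in
/-- The vertex `u` is a pendent vertex of the pendent edge attached at `v₃` of `R(1,1,2,4)`, and `v`
one of the pendent edge attached at `v₆` of `R(1,3,1,3)`. The first two conjuncts of the conclusion
say that the maxima defining the spectral radii exist. -/
theorem theorem3p4 {W : Type*} (r : ℕ) (hr : 3 ≤ r) (Γ : Hypergraph W) (hΓ : Γ.IsSupertree r)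
    (w : W) (hw : w ∈ Γ.vertexSet) (j j' : Fin (r - 1))
    (u : Hypergraph.RVertex r 1 1 2 4) (hu : u = Hypergraph.pendentAtSecond r 1 1 2 4 j)
    (v : Hypergraph.RVertex r 1 3 1 3) (hv : v = Hypergraph.pendentAtThird r 1 3 1 3 j')
    (G : Hypergraph (Hypergraph.RVertex r 1 1 2 4 ⊕ W))
    (hG : G = (Hypergraph.supertreeR r 1 1 2 4).glue u Γ w)
    (H : Hypergraph (Hypergraph.RVertex r 1 3 1 3 ⊕ W))
    (hH : H = (Hypergraph.supertreeR r 1 3 1 3).glue v Γ w) :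
    IsGreatest (G.eigenvalueModuli r) (G.spectralRadius r) ∧
    IsGreatest (H.eigenvalueModuli r) (H.spectralRadius r) ∧
    G.spectralRadius r = H.spectralRadius r ∧
    G.matchingEnergy r = H.matchingEnergy r := by
  classical
  have hr2 : 2 ≤ r := by omega
  have := hΓ.finite.fintype
  have hfin : Γ.edgeSet.Finite := hΓ.finite.finite_subsets.subset fun e he => he.subset_vertexSet
  have := hfin.fintype
  let L := Skeleton.rooted hΓ.uniform hw
  obtain ⟨K, hK⟩ := exists_skeleton_traceSecond hr2 j
  obtain ⟨K', hK'⟩ := exists_skeleton_traceThird hr2 j'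
  rw [← hK] at hu
  rw [← hK'] at hv
  subst hu hv
  have huV := K.vertex_mem 9
  have hvV := K'.vertex_mem 9
  have hGfin : G.vertexSet.Finite := hG ▸ finite_vertexSet_glue (Set.toFinite _) hΓ.finite
  have hHfin : H.vertexSet.Finite := hH ▸ finite_vertexSet_glue (Set.toFinite _) hΓ.finite
  have hGconn : G.IsConnected := hG ▸ isConnected_supertreeR.glue hΓ.connected huV hw
  have hHconn : H.IsConnected := hH ▸ isConnected_supertreeR.glue hΓ.connected hvV hw
  have hcard : G.vertexSet.ncard = H.vertexSet.ncard := by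
    rw [hG, hH, ncard_vertexSet_glue (Set.toFinite _) hΓ.finite huV,
      ncard_vertexSet_glue (Set.toFinite _) hΓ.finite hvV, ncard_vertexSet_supertreeR,
      ncard_vertexSet_supertreeR]
  let M : Skeleton G r _ := hG ▸ K.glue hr2 L 9
  let M' : Skeleton H r _ := hH ▸ K'.glue hr2 L 9
  obtain ⟨t, ht, hGt⟩ := M.exists_isLeast_isGreatest (by omega) hGfin hGconn
  obtain ⟨t', ht', hHt⟩ := M'.exists_isLeast_isGreatest (by omega) hHfin hHconn
  -- Both radii are the least element of one and the same set.
  have htt : t = t' := by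
    rw [setOf_isReducedSolution_traceSecond] at ht
    exact ht.unique ht'
  have hGρ : G.spectralRadius r = t := hGt.csSup_eq
  have hHρ : H.spectralRadius r = t' := hHt.csSup_eq
  refine ⟨hGρ ▸ hGt, hHρ ▸ hHt, by rw [hGρ, hHρ, htt], ?_⟩
  have hnum : ∀ k, G.numMatchings k = H.numMatchings k := fun k => by
    rw [M.numMatchings_eq, M'.numMatchings_eq]
    exact ncard_isMatching_traceSecond _ k
  rw [matchingEnergy, matchingEnergy, matchingPolynomial, matchingPolynomial, hcard]
  simp only [hnum]
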